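/- Let $N,m\ge 1$ be integers and let $\mathcal H=L^2(\mathbb R^N)$, so that $\mathcal H^{\otimes m}=L^2((\mathbb R^N)^m)$. For $\vec w=(\vec q,\vec p)\in\mathbb R^{2N}$ let $W(\vec w)$ be the Weyl operator $(W(\vec w)\varphi)(\vec x)=e^{\frac i2\vec q^T\vec p}\,e^{i\vec p^T(\vec x-\vec q)}\varphi(\vec x-\vec q)$ on $\mathcal H$, let $\Omega=\begin{pmatrix}0&1_N\\-1_N&0\end{pmatrix}$, and for $\vec z=(\vec w_1,\dots,\vec w_m)\in\mathbb R^{2mN}$ let $W_m(\vec z)=W(\vec w_1)\otimes\cdots\otimes W(\vec w_m)$. Let $J_m:\mathbb R^{2N}\to\mathbb R^{2mN}$, $J_m\vec w=(\vec w,\dots,\vec w)$, and $W^{\otimes m}(\vec w)=W_m(J_m\vec w)$. A channel is a normal unital completely positive linear map $\Psi:\mathcal L(\mathcal H^{\otimes m})\to\mathcal L(\mathcal H)$; it belongs to $\mathbf{Ch}_W^{W^{\otimes m}}$ if $\Psi\big(W^{\otimes m}(\vec w)XW^{\otimes m}(\vec w)^*\big)=W(\vec w)\Psi(X)W(\vec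 w)^*$ for all $\vec w\in\mathbb R^{2N}$ and $X\in\mathcal L(\mathcal H^{\otimes m})$. Its predual $\Psi_*$ is given by $\mathrm{tr}[\Psi_*(S)X]=\mathrm{tr}[S\Psi(X)]$ for trace-class $S$ on $\mathcal H$ and $X\in\mathcal L(\mathcal H^{\otimes m})$. The Fourier transforms of trace-class operators $S$ on $\mathcal H$ and $T$ on $\mathcal H^{\otimes m}$ are $\hat S(\vec w)=\mathrm{tr}[SW(\vec w)]$ and $\hat T(\vec z)=\mathrm{tr}[TW_m(\vec z)]$. A function on $\mathbb R^d$ is called Gaussian if it has the form $\vec z\mapsto C\,e^{-\frac14\vec z^TV\vec z-i\vec d^T\vec z}$ with $C>0$, $V$ a real symmetric positive definite matrix and $\vec d$ a real vector. The channel $\Psi$ is Gaussian if $\widehat{\Psi_*(S)}$ is a Gaussian function for every positive trace-class operator $S$ on $\mathcal H$ such that $\hat S$ is a Gaussian function. Theorem. A channel $\Psi\in\mathbf{Ch}_W^{W^{\otimes m}}$ is Gaussian if and only if there are a real symmetric $2mN\times 2mN$ matrix $B=(B_{kl})_{k,l=1}^m$ with $2N\times 2N$ blocks $B_{kl}$ such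 that the complex $m\times m$ block matrix with diagonal blocks $B_{kk}$ and off-diagonal blocks $B_{kl}-i\Omega$ $(k\ne l)$ is positive semidefinite, and a vector $\vec c\in\mathbb R^{2mN}$, such that $$\Psi\big(W_m(\vec z)\big)=e^{-\frac14\vec z^TB\vec z-i\vec c^T\vec z}\,W(J_m^T\vec z),\qquad \vec z\in\mathbb R^{2mN}.$$ Moreover, the vector $\vec c$ is arbitrary: if $\Psi\in\mathbf{Ch}_W^{W^{\otimes m}}$ has this form with such a $B$ and some $\vec c$, then for every $\vec c\,'\in\mathbb R^{2mN}$ there is a Gaussian channel $\Psi'\in\mathbf{Ch}_W^{W^{\otimes m}}$ that has this form with $B$ and $\vec c\,'$. -/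

import Mathlib

open MeasureTheory
open scoped ComplexOrder InnerProductSpace

noncomputable section

namespace WeylChannel

/-! ### Trace and channels -/

section Channels

variable {H K : Type*}
  [NormedAddCommGroup H] [InnerProductSpace ℂ H] [CompleteSpace H]
  [NormedAddCommGroup K] [InnerProductSpace ℂ K] [CompleteSpace K]

theorem exists_basis (H : Type*) [NormedAddCommGroup H] [InnerProductSpace ℂ H]
    [CompleteSpace H] : ∃ s : Set H, Nonempty (HilbertBasis s ℂ H) :=
  let ⟨s, b, _⟩ := exists_hilbertBasis ℂ H
  ⟨s, ⟨b⟩⟩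

/-- An orthonormal basis of `H`, fixed once and for all. -/
def stdBasis (H : Type*) [NormedAddCommGroup H] [InnerProductSpace ℂ H] [CompleteSpace H] :
    HilbertBasis (exists_basis H).choose ℂ H :=
  (exists_basis H).choose_spec.some

/-- The trace of an operator; for a trace-class operator the series converges absolutely and its
sum does not depend on the orthonormal basis. -/
def trace (T : H →L[ℂ] H) : ℂ := ∑' i, ⟪stdBasis H i, T (stdBasis H i)⟫_ℂ

/-- Positive trace-class operators (for positive operators, summability of the diagonal does not
depend on the orthonormal basis). -/
structure IsPositiveTraceClass (S : H →L[ℂ] H) : Prop where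
  isPositive : S.IsPositive
  summable : Summable fun i => ⟪stdBasis H i, S (stdBasis H i)⟫_ℂ

/-- `∑ i j, ⟪φ i, Φ (B i ^* B j) φ j⟫ ≥ 0` for all finite families. -/
def IsCompletelyPositive (Φ : (K →L[ℂ] K) →ₗ[ℂ] (H →L[ℂ] H)) : Prop :=
  ∀ (n : ℕ) (B : Fin n → (K →L[ℂ] K)) (φ : Fin n → H),
    0 ≤ ∑ i, ∑ j, ⟪φ i, Φ (ContinuousLinearMap.adjoint (B i) ∘L B j) (φ j)⟫_ℂ

/-- `Φ` preserves suprema (in the Loewner order) of increasing nets of self-adjoint operators; nets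
are given by their ranges, which are upward directed sets. -/
def IsNormalMap (Φ : (K →L[ℂ] K) →ₗ[ℂ] (H →L[ℂ] H)) : Prop :=
  ∀ (s : Set (K →L[ℂ] K)) (b : K →L[ℂ] K), s.Nonempty → DirectedOn (· ≤ ·) s →
    (∀ a ∈ s, IsSelfAdjoint a) → IsLUB s b → IsLUB (Φ '' s) (Φ b)

/-- Channels in the Heisenberg picture, from operators on `K` to operators on `H`: normal unital
completely positive linear maps. -/
structure IsChannel (Φ : (K →L[ℂ] K) →ₗ[ℂ] (H →L[ℂ] H)) : Prop where
  completelyPositive : IsCompletelyPositive Φ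
  unital : Φ (ContinuousLinearMap.id ℂ K) = ContinuousLinearMap.id ℂ H
  normal : IsNormalMap Φ

/-- `(U, V)`-covariance: `Φ (V g B (V g)^*) = U g Φ(B) (U g)^*`. -/
def IsCovariant {G : Type*} (U : G → (H →L[ℂ] H)) (V : G → (K →L[ℂ] K))
    (Φ : (K →L[ℂ] K) →ₗ[ℂ] (H →L[ℂ] H)) : Prop :=
  ∀ (g : G) (B : K →L[ℂ] K),
    Φ (V g ∘L B ∘L ContinuousLinearMap.adjoint (V g)) =
      U g ∘L Φ B ∘L ContinuousLinearMap.adjoint (U g)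

end Channels

/-! ### The Weyl representation -/

section Weyl

variable {ι : Type*} [Fintype ι]

/-- The Hilbert space `L²(ℝ^ι)`. -/
abbrev L2 (ι : Type*) [Fintype ι] : Type _ := Lp ℂ 2 (volume : Measure (ι → ℝ))

/-- `(U(q) φ)(x) = φ(x - q)`. -/
def translation (q : ι → ℝ) : L2 ι →L[ℂ] L2 ι :=
  (Lp.compMeasurePreservingₗᵢ ℂ (fun x : ι → ℝ => x - q)
    (measurePreserving_sub_right volume q)).toContinuousLinearMap

theorem norm_char_mul (p x : ι → ℝ) (c : ℂ) :
    ‖Complex.exp (Complex.I * (p ⬝ᵥ x : ℝ)) * c‖ = ‖c‖ := by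
  rw [norm_mul, mul_comm Complex.I, Complex.norm_exp_ofReal_mul_I, one_mul]

theorem memLp_char_mul (p : ι → ℝ) (φ : L2 ι) :
    MemLp (fun x => Complex.exp (Complex.I * (p ⬝ᵥ x : ℝ)) * φ x) 2 volume := by
  refine (Lp.memLp φ).of_le ?_ (Filter.Eventually.of_forall fun x => (norm_char_mul p x _).le)
  refine AEStronglyMeasurable.mul ?_ (Lp.aestronglyMeasurable φ)
  refine Continuous.aestronglyMeasurable ?_
  unfold dotProduct
  fun_prop

/-- `(V(p) φ)(x) = e^{i p·x} φ(x)`. -/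
def boost (p : ι → ℝ) : L2 ι →L[ℂ] L2 ι :=
  LinearMap.mkContinuous
    { toFun := fun φ => (memLp_char_mul p φ).toLp _
      map_add' := by
        intro φ ψ
        rw [← MemLp.toLp_add]
        refine MemLp.toLp_congr _ _ ?_
        filter_upwards [Lp.coeFn_add φ ψ] with x hx
        simp only [Pi.add_apply] at hx ⊢
        rw [hx, mul_add]
      map_smul' := by
        intro c φ
        rw [RingHom.id_apply, ← MemLp.toLp_const_smul]
        refine MemLp.toLp_congr _ _ ?_
        filter_upwards [Lp.coeFn_smul c φ] with x hx
        simp only [Pi.smul_apply, smul_eq_mul] at hx ⊢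
        rw [hx]; ring }
    1
    (by
      intro φ
      rw [one_mul]
      refine Lp.norm_le_norm_of_ae_le ?_
      filter_upwards [(memLp_char_mul p φ).coeFn_toLp] with x hx
      simp only [LinearMap.coe_mk, AddHom.coe_mk]
      rw [hx, norm_char_mul])

/-- The Weyl operator `W(q, p) = e^{(i/2) q·p} U(q) V(p)` on `L²(ℝ^ι)`; a point `w` of the phase
space `ℝ^ι × ℝ^ι` has position part `w ∘ Sum.inl` and momentum part `w ∘ Sum.inr`. -/
def weyl (w : ι ⊕ ι → ℝ) : L2 ι →L[ℂ] L2 ι :=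
  Complex.exp (Complex.I / 2 * ((w ∘ Sum.inl) ⬝ᵥ (w ∘ Sum.inr) : ℝ)) •
    (translation (w ∘ Sum.inl) ∘L boost (w ∘ Sum.inr))

theorem coeFn_translation (q : ι → ℝ) (φ : L2 ι) :
    translation q φ =ᵐ[volume] fun x => φ (x - q) :=
  Lp.coeFn_compMeasurePreserving φ (measurePreserving_sub_right volume q)

theorem coeFn_boost (p : ι → ℝ) (φ : L2 ι) :
    boost p φ =ᵐ[volume] fun x => Complex.exp (Complex.I * (p ⬝ᵥ x : ℝ)) * φ x :=
  (memLp_char_mul p φ).coeFn_toLp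

theorem coeFn_weyl (w : ι ⊕ ι → ℝ) (φ : L2 ι) :
    weyl w φ =ᵐ[volume] fun x =>
      Complex.exp (Complex.I / 2 * ((w ∘ Sum.inl) ⬝ᵥ (w ∘ Sum.inr) : ℝ)) *
        (Complex.exp (Complex.I * ((w ∘ Sum.inr) ⬝ᵥ (x - w ∘ Sum.inl) : ℝ)) *
          φ (x - w ∘ Sum.inl)) := by
  have h1 := Lp.coeFn_smul
    (Complex.exp (Complex.I / 2 * ((w ∘ Sum.inl) ⬝ᵥ (w ∘ Sum.inr) : ℝ)))
    ((translation (w ∘ Sum.inl) ∘L boost (w ∘ Sum.inr)) φ)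
  have h2 := coeFn_translation (w ∘ Sum.inl) (boost (w ∘ Sum.inr) φ)
  have h3 := (measurePreserving_sub_right (volume : Measure (ι → ℝ))
    (w ∘ Sum.inl)).quasiMeasurePreserving.ae_eq_comp (coeFn_boost (w ∘ Sum.inr) φ)
  filter_upwards [h1, h2, h3] with x h1 h2 h3
  simp only [Pi.smul_apply, smul_eq_mul, Function.comp_def] at h1 h2 h3
  rw [weyl, _root_.smul_apply]
  refine h1.trans ?_
  refine congrArg _ (h2.trans h3)

end Weyl

/-! ### Tensor powers

The Hilbert tensor power `L²(ℝ^N)^{⊗ m}` is realized as `L²((ℝ^N)^m)`: the facts below say that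
elementary tensors multiply inner products, that they span a dense subspace, and that the Weyl
operators of the product phase space are tensor products of Weyl operators. -/

section Tensor

variable {N m : ℕ}

/-- The `m`-fold Hilbert tensor power of `L²(ℝ^N)`. -/
abbrev L2Pow (N m : ℕ) : Type := L2 (Fin m × Fin N)

/-- The `k`-th component in `ℝ^{2N}` of a point of `ℝ^{2mN} = (ℝ^{2N})^m`. -/
def component (z : Fin m × (Fin N ⊕ Fin N) → ℝ) (k : Fin m) : Fin N ⊕ Fin N → ℝ :=
  fun a => z (k, a)

/-- `W_m(z_1, …, z_m) = W(z_1) ⊗ ⋯ ⊗ W(z_m)`, as the Weyl operator of the product phase space;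
see `weylPow_tensorVec`. -/
def weylPow (z : Fin m × (Fin N ⊕ Fin N) → ℝ) : L2Pow N m →L[ℂ] L2Pow N m :=
  weyl (Sum.elim (fun a => z (a.1, Sum.inl a.2)) (fun a => z (a.1, Sum.inr a.2)))

theorem measurePreserving_curry (N m : ℕ) :
    MeasurePreserving (fun (x : Fin m × Fin N → ℝ) (k : Fin m) (j : Fin N) => x (k, j))
      volume volume := by
  have h : MeasurePreserving (MeasurableEquiv.curry (Fin m) (Fin N) ℝ).symm volume volume := by
    refine ⟨MeasurableEquiv.measurable _, ?_⟩
    refine (Measure.pi_eq fun s hs => ?_).symm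
    rw [Measure.map_apply (MeasurableEquiv.measurable _) (MeasurableSet.univ_pi hs)]
    have : (MeasurableEquiv.curry (Fin m) (Fin N) ℝ).symm ⁻¹' Set.univ.pi s =
        Set.univ.pi fun k => Set.univ.pi fun j => s (k, j) := by
      ext x
      simp only [Set.mem_preimage, Set.mem_univ_pi, Prod.forall]
      exact Iff.rfl
    rw [this, volume_pi, Measure.pi_pi, Fintype.prod_prod_type]
    simp_rw [volume_pi, Measure.pi_pi]
  exact h.symm

theorem quasi_slice (k : Fin m) :
    Measure.QuasiMeasurePreserving (fun (x : Fin m × Fin N → ℝ) (j : Fin N) => x (k, j))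
      volume volume :=
  (Measure.quasiMeasurePreserving_eval (μ := fun _ : Fin m => (volume : Measure (Fin N → ℝ)))
    k).comp (measurePreserving_curry N m).quasiMeasurePreserving

theorem memLp_tensor (φ : Fin m → L2 (Fin N)) :
    MemLp (fun x : Fin m × Fin N → ℝ => ∏ k, φ k fun j => x (k, j)) 2 volume := by
  have hm : AEStronglyMeasurable
      (fun x : Fin m × Fin N → ℝ => ∏ k, φ k fun j => x (k, j)) volume :=
    Finset.aestronglyMeasurable_fun_prod _ fun k _ =>
      (Lp.aestronglyMeasurable (φ k)).comp_quasiMeasurePreserving (quasi_slice k)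
  rw [memLp_two_iff_integrable_sq_norm hm]
  have h : Integrable (fun y : Fin m → Fin N → ℝ => ∏ k, ‖φ k (y k)‖ ^ 2) volume :=
    Integrable.fintype_prod (f := fun k y => ‖φ k y‖ ^ 2) fun k =>
      (memLp_two_iff_integrable_sq_norm (Lp.aestronglyMeasurable (φ k))).1 (Lp.memLp (φ k))
  refine ((measurePreserving_curry N m).integrable_comp_of_integrable h).congr ?_
  refine Filter.Eventually.of_forall fun x => ?_
  simp only [Function.comp_apply, norm_prod, Finset.prod_pow]

/-- The elementary tensor `φ_1 ⊗ ⋯ ⊗ φ_m`, that is, `x ↦ φ_1(x_1) ⋯ φ_m(x_m)`. -/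
def tensorVec (φ : Fin m → L2 (Fin N)) : L2Pow N m := (memLp_tensor φ).toLp _

theorem coeFn_tensorVec (φ : Fin m → L2 (Fin N)) :
    tensorVec φ =ᵐ[volume] fun x => ∏ k, φ k fun j => x (k, j) :=
  (memLp_tensor φ).coeFn_toLp

theorem inner_tensorVec (φ ψ : Fin m → L2 (Fin N)) :
    ⟪tensorVec φ, tensorVec ψ⟫_ℂ = ∏ k, ⟪φ k, ψ k⟫_ℂ := by
  simp_rw [L2.inner_def]
  rw [← integral_fintype_prod_volume_eq_prod (fun k (y : Fin N → ℝ) => ⟪φ k y, ψ k y⟫_ℂ)]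
  have hc : MeasurableEmbedding
      (fun (x : Fin m × Fin N → ℝ) (k : Fin m) (j : Fin N) => x (k, j)) :=
    (MeasurableEquiv.curry (Fin m) (Fin N) ℝ).measurableEmbedding
  rw [← (measurePreserving_curry N m).integral_comp hc]
  refine integral_congr_ae ?_
  filter_upwards [coeFn_tensorVec φ, coeFn_tensorVec ψ] with x h1 h2
  simp only [h1, h2, RCLike.inner_apply, map_prod, Finset.prod_mul_distrib]

theorem dense_span_tensorVec (N m : ℕ) :
    Dense (Submodule.span ℂ (Set.range (tensorVec (N := N) (m := m))) : Set (L2Pow N m)) := by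
  rw [Submodule.dense_iff_topologicalClosure_eq_top, Submodule.topologicalClosure_eq_top_iff,
    Submodule.eq_bot_iff]
  intro f hf
  have hbox : ∀ s : Fin m × Fin N → Set ℝ, (∀ a, MeasurableSet (s a)) →
      (∀ a, volume (s a) ≠ ⊤) → ∫ x in Set.univ.pi s, f x = 0 := by
    intro s hs hfin
    have hs' : ∀ k : Fin m, MeasurableSet (Set.univ.pi fun j => s (k, j)) := fun k =>
      MeasurableSet.univ_pi fun j => hs _
    have hfin' : ∀ k : Fin m, volume (Set.univ.pi fun j => s (k, j)) ≠ ⊤ := fun k => by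
      rw [volume_pi_pi]
      exact ENNReal.prod_ne_top fun j _ => hfin _
    let φ : Fin m → L2 (Fin N) := fun k => indicatorConstLp 2 (hs' k) (hfin' k) 1
    have h0 : ⟪tensorVec φ, f⟫_ℂ = 0 :=
      hf _ (Submodule.subset_span ⟨φ, rfl⟩)
    rw [L2.inner_def] at h0
    rw [← h0, ← integral_indicator (MeasurableSet.univ_pi hs)]
    refine integral_congr_ae ?_
    have h2 : ∀ k, _ := fun k => (quasi_slice (N := N) k).ae_eq_comp
      (indicatorConstLp_coeFn (p := 2) (hs := hs' k) (hμs := hfin' k) (c := (1 : ℂ)))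
    filter_upwards [coeFn_tensorVec φ, ae_all_iff.2 h2] with x h1 h2
    simp only [Function.comp_def] at h2
    rw [h1, Finset.prod_congr rfl fun k _ => h2 k]
    by_cases hx : x ∈ Set.univ.pi s
    · rw [Set.indicator_of_mem hx, Finset.prod_congr rfl fun k _ =>
        Set.indicator_of_mem (s := Set.univ.pi fun j => s (k, j)) (a := fun j => x (k, j))
          (fun j _ => hx (k, j) trivial) _]
      simp
    · rw [Set.indicator_of_notMem hx]
      simp only [Set.mem_univ_pi, not_forall] at hx
      obtain ⟨⟨k, j⟩, hkj⟩ := hx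
      rw [Finset.prod_eq_zero (Finset.mem_univ k)]
      · simp
      · exact Set.indicator_of_notMem (fun h => hkj (Set.mem_univ_pi.1 h j)) _
  let Q : ℕ → Set (Fin m × Fin N → ℝ) := fun n => Set.univ.pi fun _ => Set.Icc (-(n : ℝ)) n
  have hQ : ∀ n, f =ᵐ[volume.restrict (Q n)] 0 := by
    intro n
    have hQfin : volume (Q n) ≠ ⊤ := by
      rw [volume_pi_pi]
      exact ENNReal.prod_ne_top fun a _ => by simp
    have hint : IntegrableOn f (Q n) volume := by
      have : IsFiniteMeasure (volume.restrict (Q n)) := isFiniteMeasure_restrict.2 hQfin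
      exact ((Lp.memLp f).restrict (Q n)).integrable (by norm_num)
    have key : ∀ A, MeasurableSet A → ∫ x in A, f x ∂(volume.restrict (Q n)) = 0 := by
      intro A hA
      induction A, hA using MeasurableSpace.induction_on_inter
        (generateFrom_pi (α := fun _ : Fin m × Fin N => ℝ)).symm isPiSystem_pi with
      | empty => simp
      | basic t ht =>
        obtain ⟨s, hs, rfl⟩ := ht
        have hs' : ∀ a, MeasurableSet (s a) := fun a => hs a trivial
        rw [Measure.restrict_restrict (MeasurableSet.univ_pi hs'), ← Set.pi_inter_distrib]
        refine hbox _ (fun a => (hs' a).inter measurableSet_Icc) fun a => ?_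
        exact measure_ne_top_of_subset Set.inter_subset_right (by simp)
      | compl t ht ih =>
        have h1 := integral_add_compl ht hint
        have h2 : ∫ x in Q n, f x = 0 :=
          hbox _ (fun _ => measurableSet_Icc) (fun _ => by simp)
        rw [ih, zero_add, h2] at h1
        exact h1
      | iUnion g hd hg ih =>
        rw [integral_iUnion hg hd (Integrable.integrableOn hint)]
        simp [ih]
    exact hint.ae_eq_zero_of_forall_setIntegral_eq_zero fun A hA _ => key A hA
  have hU : ⋃ n, Q n = Set.univ := by
    refine Set.eq_univ_of_forall fun x => ?_
    obtain ⟨n, hn⟩ := exists_nat_ge ‖x‖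
    refine Set.mem_iUnion.2 ⟨n, fun a _ => ?_⟩
    exact abs_le.1 ((norm_le_pi_norm x a).trans hn)
  refine (Lp.eq_zero_iff_ae_eq_zero).2 ?_
  have := (ae_restrict_iUnion_iff Q fun x => f x = 0).2 hQ
  rwa [hU, Measure.restrict_univ] at this

theorem weylPow_tensorVec (z : Fin m × (Fin N ⊕ Fin N) → ℝ) (φ : Fin m → L2 (Fin N)) :
    weylPow z (tensorVec φ) = tensorVec fun k => weyl (component z k) (φ k) := by
  refine Lp.ext ?_
  have h1 := coeFn_tensorVec fun k => weyl (component z k) (φ k)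
  have h2 : ∀ k, _ := fun k => (quasi_slice (N := N) k).ae_eq_comp
    (coeFn_weyl (component z k) (φ k))
  have h3 := coeFn_weyl (Sum.elim (fun a => z (a.1, Sum.inl a.2))
    (fun a => z (a.1, Sum.inr a.2))) (tensorVec φ)
  have h4 := (measurePreserving_sub_right (volume : Measure (Fin m × Fin N → ℝ))
    (fun a => z (a.1, Sum.inl a.2))).quasiMeasurePreserving.ae_eq_comp (coeFn_tensorVec φ)
  filter_upwards [h1, h3, h4, ae_all_iff.2 h2] with x h1 h3 h4 h2
  simp only [Function.comp_def] at h2 h4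
  rw [h1]
  refine h3.trans ?_
  simp only [Sum.elim_comp_inl, Sum.elim_comp_inr]
  rw [h4, Finset.prod_congr rfl fun k _ => h2 k, Finset.prod_mul_distrib,
    Finset.prod_mul_distrib, ← Complex.exp_sum, ← Complex.exp_sum]
  congr 1
  · congr 1
    simp only [dotProduct, Fintype.sum_prod_type, component]
    push_cast
    rw [Finset.mul_sum]
  · congr 1
    congr 1
    simp only [dotProduct, Fintype.sum_prod_type, component, Pi.sub_apply]
    push_cast
    rw [Finset.mul_sum]

end Tensor

/-! ### Gaussian channels -/

section Gaussian

variable {κ : Type*} [Fintype κ]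

/-- `F(z) = C exp(-¼ zᵀ V z - i dᵀ z)` with `C > 0`, `V` real positive definite and `d` real. -/
def IsGaussianFunction (F : (κ → ℝ) → ℂ) : Prop :=
  ∃ (C : ℝ) (V : Matrix κ κ ℝ) (d : κ → ℝ), 0 < C ∧ V.PosDef ∧
    ∀ z, F z = C * Complex.exp
      (-(1 / 4) * (z ⬝ᵥ V.mulVec z : ℝ) - Complex.I * (d ⬝ᵥ z : ℝ))

variable {N m : ℕ}

/-- The Fourier transform `w ↦ tr[S W(w)]`. -/
def fourier (S : L2 (Fin N) →L[ℂ] L2 (Fin N)) (w : Fin N ⊕ Fin N → ℝ) : ℂ :=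
  trace (S ∘L weyl w)

/-- The Fourier transform `z ↦ tr[Ψ_*(S) W_m(z)]` of the image of `S` under the predual `Ψ_*`,
where `Ψ_*` is defined by `tr[Ψ_*(S) B] = tr[S Ψ(B)]`. -/
def fourierPredual (Ψ : (L2Pow N m →L[ℂ] L2Pow N m) →ₗ[ℂ] (L2 (Fin N) →L[ℂ] L2 (Fin N)))
    (S : L2 (Fin N) →L[ℂ] L2 (Fin N)) (z : Fin m × (Fin N ⊕ Fin N) → ℝ) : ℂ :=
  trace (S ∘L Ψ (weylPow z))

/-- `Ψ` is Gaussian: the predual maps positive trace-class operators with Gaussian Fourier transform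
to operators with Gaussian Fourier transform. -/
def IsGaussianChannel
    (Ψ : (L2Pow N m →L[ℂ] L2Pow N m) →ₗ[ℂ] (L2 (Fin N) →L[ℂ] L2 (Fin N))) : Prop :=
  ∀ S : L2 (Fin N) →L[ℂ] L2 (Fin N), IsPositiveTraceClass S →
    IsGaussianFunction (fourier S) → IsGaussianFunction (fourierPredual Ψ S)

/-- The symplectic matrix with blocks `0, 1, -1, 0`. -/
def Omega (N : ℕ) : Matrix (Fin N ⊕ Fin N) (Fin N ⊕ Fin N) ℝ :=
  Matrix.fromBlocks 0 1 (-1) 0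

/-- The matrix of `w ↦ (w, …, w)`. -/
def diagMat (N m : ℕ) : Matrix (Fin m × (Fin N ⊕ Fin N)) (Fin N ⊕ Fin N) ℝ :=
  (1 : Matrix (Fin N ⊕ Fin N) (Fin N ⊕ Fin N) ℝ).submatrix Prod.snd id

/-- `W^{⊗ m}(w) = W(w) ⊗ ⋯ ⊗ W(w)`. -/
def weylDiag (N m : ℕ) (w : Fin N ⊕ Fin N → ℝ) : L2Pow N m →L[ℂ] L2Pow N m :=
  weylPow fun a => w a.2

/-- The complex block matrix with diagonal blocks `B_kk` and off-diagonal blocks `B_kl - i Ω`. -/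
def blockMat (B : Matrix (Fin m × (Fin N ⊕ Fin N)) (Fin m × (Fin N ⊕ Fin N)) ℝ) :
    Matrix (Fin m × (Fin N ⊕ Fin N)) (Fin m × (Fin N ⊕ Fin N)) ℂ :=
  Matrix.of fun a b =>
    if a.1 = b.1 then (B a b : ℂ) else (B a b : ℂ) - Complex.I * (Omega N a.2 b.2 : ℂ)

/-- `Ψ(W_m(z)) = exp(-¼ zᵀ B z - i cᵀ z) W(J_mᵀ z)` for all `z`. -/
def HasGaussianForm
    (Ψ : (L2Pow N m →L[ℂ] L2Pow N m) →ₗ[ℂ] (L2 (Fin N) →L[ℂ] L2 (Fin N)))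
    (B : Matrix (Fin m × (Fin N ⊕ Fin N)) (Fin m × (Fin N ⊕ Fin N)) ℝ)
    (c : Fin m × (Fin N ⊕ Fin N) → ℝ) : Prop :=
  ∀ z : Fin m × (Fin N ⊕ Fin N) → ℝ,
    Ψ (weylPow z) =
      Complex.exp (-(1 / 4) * (z ⬝ᵥ B.mulVec z : ℝ) - Complex.I * (c ⬝ᵥ z : ℝ)) •
        weyl ((diagMat N m).transpose.mulVec z)

end Gaussian

end WeylChannel

end

open WeylChannel

/-! Covariance fixes the channel on Weyl operators up to a scalar function. Conjugating W_m(z) by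
W^{⊗m}(w) only multiplies it by a phase, and that phase depends on z through J_mᵀ z alone. So
Ψ(W_m(z)) has the same commutation phases with all W(w) as W(J_mᵀ z), and irreducibility of the Weyl
representation gives Ψ(W_m(z)) = f(z) W(J_mᵀ z) (`IsCovariant.exists_weylPow_eq`). On the Fourier
side the predual therefore sends Ŝ to f · (Ŝ ∘ J_mᵀ).

If f is the exponential given by B and c, exponents add, and the only issue is strict positivity of
B + J V Jᵀ (`posDef_add_diagMat_mul`): V controls vectors outside ker Jᵀ, and a null vector inside
it would be symplectically orthogonal to everything.

Conversely, one test state suffices. The projection onto the Gaussian vector, up to normalization,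
has a nowhere vanishing Gaussian Fourier transform, so f is a quotient of Gaussians and B = V - J
Jᵀ. Complete positivity tested on Weyl operators makes f(z_j - z_i), times the phase of the
off-diagonal symplectic blocks, a positive kernel (`IsCompletelyPositive.kernel_nonneg`). After
rescaling the coefficients it becomes exp(½ z_iᵀ (B - iΩ_off) z_j), with Ω_off those blocks, and its
first-order behaviour at the origin is the matrix condition on B.

The vector c is moved freely by conjugating the input with a Weyl operator. -/

noncomputable section

namespace WeylChannel

/-! ### Weyl commutation relations -/

section WeylRelations

variable {ι : Type*} [Fintype ι]

/-- The symplectic form `σ(a, b) = q_a · p_b - q_b · p_a`. -/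
def symp (a b : ι ⊕ ι → ℝ) : ℝ :=
  (a ∘ Sum.inl) ⬝ᵥ (b ∘ Sum.inr) - (b ∘ Sum.inl) ⬝ᵥ (a ∘ Sum.inr)

theorem symp_swap (a b : ι ⊕ ι → ℝ) : symp b a = -symp a b := by
  simp [symp]

theorem symp_self (a : ι ⊕ ι → ℝ) : symp a a = 0 := by
  simp [symp]

theorem symp_neg_left (a b : ι ⊕ ι → ℝ) : symp (-a) b = -symp a b := by
  simp only [symp, dotProduct, Function.comp_apply, Pi.neg_apply, neg_mul, mul_neg,
    Finset.sum_neg_distrib]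
  ring

theorem symp_neg_right (a b : ι ⊕ ι → ℝ) : symp a (-b) = -symp a b := by
  rw [symp_swap, symp_neg_left, symp_swap a b, neg_neg]

theorem symp_add_left (a b c : ι ⊕ ι → ℝ) : symp (a + b) c = symp a c + symp b c := by
  simp only [symp, dotProduct, Function.comp_apply, Pi.add_apply, add_mul, mul_add,
    Finset.sum_add_distrib]
  ring

theorem symp_add_right (a b c : ι ⊕ ι → ℝ) : symp a (b + c) = symp a b + symp a c := by
  rw [symp_swap, symp_add_left, symp_swap a b, symp_swap a c]
  ring

theorem weyl_zero : weyl (0 : ι ⊕ ι → ℝ) = ContinuousLinearMap.id ℂ (L2 ι) := by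
  ext1 φ
  refine Lp.ext ?_
  filter_upwards [coeFn_weyl 0 φ] with x hx
  rw [hx]
  simp [Pi.zero_comp]

theorem coeFn_weyl_eq_phase (w : ι ⊕ ι → ℝ) (φ : L2 ι) :
    weyl w φ =ᵐ[volume] fun x =>
      Complex.exp (((w ∘ Sum.inr) ⬝ᵥ x - (w ∘ Sum.inl) ⬝ᵥ (w ∘ Sum.inr) / 2 : ℝ) * Complex.I) *
        φ (x - w ∘ Sum.inl) := by
  filter_upwards [coeFn_weyl w φ] with x hx
  rw [hx, ← mul_assoc, ← Complex.exp_add, dotProduct_sub,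
    dotProduct_comm (w ∘ Sum.inr) (w ∘ Sum.inl)]
  congr 2
  push_cast
  ring

theorem coeFn_weyl_sub (w : ι ⊕ ι → ℝ) (φ : L2 ι) (q : ι → ℝ) :
    ∀ᵐ x, weyl w φ (x - q) =
      Complex.exp
        (((w ∘ Sum.inr) ⬝ᵥ (x - q) - (w ∘ Sum.inl) ⬝ᵥ (w ∘ Sum.inr) / 2 : ℝ) * Complex.I) *
        φ (x - q - w ∘ Sum.inl) :=
  (measurePreserving_sub_right (volume : Measure (ι → ℝ)) q).quasiMeasurePreserving.ae
    (coeFn_weyl_eq_phase w φ)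

/-- The canonical commutation relations in Weyl form. -/
theorem weyl_comp (a b : ι ⊕ ι → ℝ) :
    weyl a ∘L weyl b = Complex.exp (-(Complex.I / 2) * (symp a b : ℝ)) • weyl (a + b) := by
  ext1 φ
  refine Lp.ext ?_
  rw [_root_.smul_apply]
  filter_upwards [coeFn_weyl_eq_phase a (weyl b φ), coeFn_weyl_sub b φ (a ∘ Sum.inl),
    coeFn_weyl_eq_phase (a + b) φ,
    Lp.coeFn_smul (Complex.exp (-(Complex.I / 2) * (symp a b : ℝ))) (weyl (a + b) φ)]
    with x h1 h2 h3 h4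
  refine h1.trans ?_
  have e1 : (a + b) ∘ Sum.inl = a ∘ Sum.inl + b ∘ Sum.inl := rfl
  have e2 : (a + b) ∘ Sum.inr = a ∘ Sum.inr + b ∘ Sum.inr := rfl
  rw [h4, Pi.smul_apply, h3, h2, e1, e2, symp, smul_eq_mul, ← mul_assoc, ← mul_assoc,
    ← Complex.exp_add, ← Complex.exp_add, sub_sub]
  congr 2
  simp only [dotProduct_add, add_dotProduct, dotProduct_sub]
  rw [dotProduct_comm (b ∘ Sum.inr) (a ∘ Sum.inl)]
  push_cast
  ring

theorem adjoint_weyl (w : ι ⊕ ι → ℝ) :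
    ContinuousLinearMap.adjoint (weyl w) = weyl (-w) := by
  symm
  rw [ContinuousLinearMap.eq_adjoint_iff]
  intro φ ψ
  rw [L2.inner_def, L2.inner_def, ← integral_sub_right_eq_self _ (w ∘ Sum.inl)]
  refine integral_congr_ae ?_
  filter_upwards [coeFn_weyl_sub (-w) φ (w ∘ Sum.inl), coeFn_weyl_eq_phase w ψ] with x h1 h2
  have e1 : (-w) ∘ Sum.inl = -(w ∘ Sum.inl) := rfl
  have e2 : (-w) ∘ Sum.inr = -(w ∘ Sum.inr) := rfl
  rw [h1, h2, e1, e2, sub_neg_eq_add, sub_add_cancel]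
  simp only [RCLike.inner_apply, map_mul, ← Complex.exp_conj, Complex.conj_I, Complex.conj_ofReal]
  rw [mul_left_comm, ← mul_assoc]
  congr 3
  simp only [neg_dotProduct, dotProduct_neg, dotProduct_sub]
  rw [dotProduct_comm (w ∘ Sum.inr) (w ∘ Sum.inl)]
  push_cast
  ring

theorem weyl_comp_neg (w : ι ⊕ ι → ℝ) :
    weyl w ∘L weyl (-w) = ContinuousLinearMap.id ℂ (L2 ι) := by
  rw [weyl_comp, symp_neg_right, symp_self, add_neg_cancel, weyl_zero]
  simp

theorem weyl_neg_comp (w : ι ⊕ ι → ℝ) :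
    weyl (-w) ∘L weyl w = ContinuousLinearMap.id ℂ (L2 ι) := by
  simpa using weyl_comp_neg (-w)

theorem weyl_conj (a b : ι ⊕ ι → ℝ) :
    weyl a ∘L weyl b ∘L ContinuousLinearMap.adjoint (weyl a) =
      Complex.exp (-Complex.I * (symp a b : ℝ)) • weyl b := by
  rw [adjoint_weyl, weyl_comp, ContinuousLinearMap.comp_smul, weyl_comp, smul_smul,
    ← Complex.exp_add, symp_neg_right, add_neg_cancel_comm_assoc, symp_add_right,
    symp_neg_right, symp_self, symp_swap a b]
  congr 2
  push_cast
  ring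

end WeylRelations

/-! ### Injectivity of the Fourier transform on integrable functions -/

section FourierUniqueness

variable {ι : Type*} [Fintype ι]

theorem measure_ext_of_integral_exp {μ ν : Measure (ι → ℝ)} [IsFiniteMeasure μ]
    [IsFiniteMeasure ν]
    (h : ∀ p : ι → ℝ, ∫ x, Complex.exp (Complex.I * (p ⬝ᵥ x : ℝ)) ∂μ =
      ∫ x, Complex.exp (Complex.I * (p ⬝ᵥ x : ℝ)) ∂ν) : μ = ν := by
  classical
  refine Measure.ext_of_charFunDual (funext fun L => ?_)
  rw [charFunDual_apply, charFunDual_apply]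
  obtain ⟨p, hp⟩ : ∃ p : ι → ℝ, ∀ x, L x = p ⬝ᵥ x := by
    refine ⟨fun i => L (Pi.single i 1), fun x => ?_⟩
    conv_lhs => rw [← Finset.univ_sum_single x, map_sum]
    refine Finset.sum_congr rfl fun i _ => ?_
    have : (Pi.single i (x i) : ι → ℝ) = x i • Pi.single i 1 := by
      rw [← Pi.single_smul, smul_eq_mul, mul_one]
    rw [this, map_smul, smul_eq_mul, mul_comm]
  simp_rw [hp, mul_comm _ Complex.I]
  exact h p

theorem integrable_exp_mul (p : ι → ℝ) {G : (ι → ℝ) → ℂ} (hG : Integrable G) :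
    Integrable fun x => Complex.exp (Complex.I * (p ⬝ᵥ x : ℝ)) * G x := by
  refine hG.bdd_mul (c := 1) ?_ (Filter.Eventually.of_forall fun x => ?_)
  · refine Continuous.aestronglyMeasurable ?_
    unfold dotProduct
    fun_prop
  · rw [mul_comm, Complex.norm_exp_ofReal_mul_I]

/-- The positive and negative parts of F are densities of two finite measures with the same
characteristic function, so these measures, and hence the two parts, coincide. -/
theorem ae_eq_zero_of_integral_exp_real {F : (ι → ℝ) → ℝ} (hF : Integrable F)
    (h : ∀ p : ι → ℝ, ∫ x, Complex.exp (Complex.I * (p ⬝ᵥ x : ℝ)) * F x = 0) : F =ᵐ[volume] 0 := by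
  have hm : AEMeasurable (fun x => ENNReal.ofReal (F x)) :=
    hF.aestronglyMeasurable.aemeasurable.ennreal_ofReal
  have hm' : AEMeasurable (fun x => ENNReal.ofReal (-F x)) :=
    hF.neg.aestronglyMeasurable.aemeasurable.ennreal_ofReal
  have h1 := isFiniteMeasure_withDensity_ofReal hF.2
  have h2 := isFiniteMeasure_withDensity_ofReal (f := fun x => -F x) hF.neg.2
  have key : volume.withDensity (fun x => ENNReal.ofReal (F x)) =
      volume.withDensity (fun x => ENNReal.ofReal (-F x)) := by
    refine measure_ext_of_integral_exp fun p => ?_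
    rw [integral_withDensity_eq_integral_toReal_smul₀ hm (by simp),
      integral_withDensity_eq_integral_toReal_smul₀ hm' (by simp), ← sub_eq_zero, ← integral_sub,
      ← h p]
    · refine integral_congr_ae (Filter.Eventually.of_forall fun x => ?_)
      have : (F x : ℂ) = ((max (F x) 0 - max (-F x) 0 : ℝ) : ℂ) := by
        congr 1
        rcases le_total 0 (F x) with h | h <;> simp [h]
      simp only [ENNReal.toReal_ofReal', Complex.real_smul]
      rw [this]
      push_cast
      ring
    · simp only [ENNReal.toReal_ofReal', Complex.real_smul]
      simp_rw [mul_comm _ (Complex.exp _)]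
      exact integrable_exp_mul p hF.pos_part.ofReal
    · simp only [ENNReal.toReal_ofReal', Complex.real_smul]
      simp_rw [mul_comm _ (Complex.exp _)]
      exact integrable_exp_mul p hF.neg_part.ofReal
  rw [withDensity_eq_iff_of_sigmaFinite hm hm'] at key
  filter_upwards [key] with x hx
  have := congrArg ENNReal.toReal hx
  simp only [ENNReal.toReal_ofReal'] at this
  rcases le_total 0 (F x) with h | h <;> simp_all

/-- An integrable function whose Fourier transform vanishes is zero almost everywhere. -/
theorem ae_eq_zero_of_integral_exp {F : (ι → ℝ) → ℂ} (hF : Integrable F)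
    (h : ∀ p : ι → ℝ, ∫ x, Complex.exp (Complex.I * (p ⬝ᵥ x : ℝ)) * F x = 0) : F =ᵐ[volume] 0 := by
  -- Conjugation replaces p by -p, so the transform of the conjugate of F vanishes too, and the real
  -- and imaginary parts reduce to the real case.
  have hconj : ∀ p : ι → ℝ,
      ∫ x, Complex.exp (Complex.I * (p ⬝ᵥ x : ℝ)) * (starRingEnd ℂ) (F x) = 0 := by
    intro p
    have := congrArg (starRingEnd ℂ) (h (-p))
    rw [← integral_conj, map_zero] at this
    rw [← this]
    refine integral_congr_ae (Filter.Eventually.of_forall fun x => ?_)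
    simp only [map_mul, ← Complex.exp_conj, Complex.conj_I, Complex.conj_ofReal, neg_dotProduct]
    push_cast
    simp
  have hFc : Integrable fun x => (starRingEnd ℂ) (F x) :=
    (Complex.conjCLE.toContinuousLinearMap.integrable_comp hF :)
  have hre : (fun x => (F x).re) =ᵐ[volume] 0 := by
    refine ae_eq_zero_of_integral_exp_real hF.re fun p => ?_
    have : ∀ x, Complex.exp (Complex.I * (p ⬝ᵥ x : ℝ)) * ((F x).re : ℂ) =
        (Complex.exp (Complex.I * (p ⬝ᵥ x : ℝ)) * F x +
          Complex.exp (Complex.I * (p ⬝ᵥ x : ℝ)) * (starRingEnd ℂ) (F x)) / 2 := by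
      intro x
      rw [Complex.re_eq_add_conj]; ring
    simp_rw [this, integral_div]
    rw [integral_add (integrable_exp_mul p hF) (integrable_exp_mul p hFc), h, hconj]
    simp
  have him : (fun x => (F x).im) =ᵐ[volume] 0 := by
    refine ae_eq_zero_of_integral_exp_real hF.im fun p => ?_
    have : ∀ x, Complex.exp (Complex.I * (p ⬝ᵥ x : ℝ)) * ((F x).im : ℂ) =
        (Complex.exp (Complex.I * (p ⬝ᵥ x : ℝ)) * F x -
          Complex.exp (Complex.I * (p ⬝ᵥ x : ℝ)) * (starRingEnd ℂ) (F x)) / (2 * Complex.I) := by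
      intro x
      rw [Complex.im_eq_sub_conj]; ring
    simp_rw [this, integral_div]
    rw [integral_sub (integrable_exp_mul p hF) (integrable_exp_mul p hFc), h, hconj]
    simp
  filter_upwards [hre, him] with x h1 h2
  exact Complex.ext h1 h2

end FourierUniqueness

/-! ### The Gaussian vector and its Weyl matrix element -/

section GaussianVector

variable {ι : Type*} [Fintype ι]

theorem memLp_gauss (ι : Type*) [Fintype ι] :
    MemLp (fun x : ι → ℝ => Complex.exp (-(1 / 2) * ∑ i, (x i : ℂ) ^ 2)) 2 volume := by
  have hm : AEStronglyMeasurable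
      (fun x : ι → ℝ => Complex.exp (-(1 / 2) * ∑ i, (x i : ℂ) ^ 2)) volume :=
    Continuous.aestronglyMeasurable (by fun_prop)
  rw [memLp_two_iff_integrable_sq_norm hm]
  have h := (GaussianFourier.integrable_cexp_neg_mul_sum_add (ι := ι) (b := 1) (by simp) 0).norm
  refine h.congr (Filter.Eventually.of_forall fun x => ?_)
  simp only [Pi.zero_apply, zero_mul, Finset.sum_const_zero, add_zero, ← norm_pow,
    ← Complex.exp_nat_mul]
  congr 2
  push_cast
  ring

/-- The Gaussian vector `x ↦ exp(-|x|² / 2)`. -/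
def gauss (ι : Type*) [Fintype ι] : L2 ι := (memLp_gauss ι).toLp _

theorem coeFn_gauss (ι : Type*) [Fintype ι] :
    gauss ι =ᵐ[volume] fun x => Complex.exp (-(1 / 2) * ∑ i, (x i : ℂ) ^ 2) :=
  (memLp_gauss ι).coeFn_toLp

/-- With w = (q, p), the integrand is exp(-|x|² + (q + ip)·x) times a constant. The Gaussian
integral contributes exp((q + ip)·(q + ip)/4), whose mixed term iq·p/2 cancels the phase of that
constant. The result never vanishes, so it can be divided out later. -/
theorem inner_gauss_weyl_gauss (w : ι ⊕ ι → ℝ) :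
    ⟪gauss ι, weyl w (gauss ι)⟫_ℂ =
      (Real.pi ^ (Fintype.card ι / 2 : ℝ) : ℝ) * Complex.exp (-(1 / 4) * (w ⬝ᵥ w : ℝ)) := by
  have h := GaussianFourier.integral_cexp_neg_mul_sum_add (ι := ι) (b := 1) (by simp)
    (fun i => w (Sum.inl i) + w (Sum.inr i) * Complex.I)
  have hq := (measurePreserving_sub_right (volume : Measure (ι → ℝ))
    (w ∘ Sum.inl)).quasiMeasurePreserving.ae (coeFn_gauss ι)
  have hI : ⟪gauss ι, weyl w (gauss ι)⟫_ℂ = ∫ x : ι → ℝ,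
      Complex.exp (-1 * ∑ i, (x i : ℂ) ^ 2 +
        ∑ i, (w (Sum.inl i) + w (Sum.inr i) * Complex.I) * x i) *
      Complex.exp (-(1 / 2) * ∑ i, (w (Sum.inl i) : ℂ) ^ 2 -
        Complex.I / 2 * ∑ i, (w (Sum.inl i) : ℂ) * w (Sum.inr i)) := by
    rw [L2.inner_def]
    refine integral_congr_ae ?_
    filter_upwards [coeFn_weyl_eq_phase w (gauss ι), coeFn_gauss ι, hq] with x h1 h2 h3
    rw [h1, h2, h3]
    simp only [RCLike.inner_apply, ← Complex.exp_conj, ← Complex.exp_add, map_mul, map_neg,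
      map_sum, map_pow, Complex.conj_ofReal, dotProduct, Function.comp_apply, Pi.sub_apply]
    congr 1
    have h12 : (starRingEnd ℂ) (1 / 2) = 1 / 2 := by simp [map_ofNat (starRingEnd ℂ) 2]
    rw [h12]
    push_cast
    simp only [sub_sq, Finset.sum_add_distrib, Finset.sum_sub_distrib, add_mul]
    have e1 : ∑ i, 2 * (x i : ℂ) * w (Sum.inl i) = 2 * ∑ i, (w (Sum.inl i) : ℂ) * x i := by
      rw [Finset.mul_sum]; exact Finset.sum_congr rfl fun i _ => by ring
    have e2 : ∑ i, (w (Sum.inr i) : ℂ) * Complex.I * x i =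
        Complex.I * ∑ i, (w (Sum.inr i) : ℂ) * x i := by
      rw [Finset.mul_sum]; exact Finset.sum_congr rfl fun i _ => by ring
    rw [e1, e2]
    ring
  rw [hI, integral_mul_const, h, mul_assoc, ← Complex.exp_add]
  congr 1
  · rw [Complex.ofReal_cpow Real.pi_pos.le]
    simp
  · congr 1
    simp only [dotProduct, Fintype.sum_sum_type]
    push_cast
    have e : ∑ i, ((w (Sum.inl i) : ℂ) + w (Sum.inr i) * Complex.I) ^ 2 =
        ∑ i, (w (Sum.inl i) : ℂ) ^ 2 - ∑ i, (w (Sum.inr i) : ℂ) ^ 2 +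
          2 * Complex.I * ∑ i, (w (Sum.inl i) : ℂ) * w (Sum.inr i) := by
      rw [Finset.mul_sum, ← Finset.sum_sub_distrib, ← Finset.sum_add_distrib]
      refine Finset.sum_congr rfl fun i _ => ?_
      linear_combination (w (Sum.inr i) : ℂ) ^ 2 * Complex.I_sq
    rw [e]
    simp only [pow_two]
    ring

end GaussianVector

/-! ### Irreducibility of the Weyl representation -/

section Irreducibility

variable {ι : Type*} [Fintype ι]

/-- Commuting with the boosts, which multiply by exp(ip·x), makes the two integrable functions have
equal Fourier transforms. This pointwise form of the adjoint relation is what makes A a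
multiplication operator. -/
theorem ae_mul_eq_of_commute_weyl {A : L2 ι →L[ℂ] L2 ι}
    (hA : ∀ w, A ∘L weyl w = weyl w ∘L A) (u φ : L2 ι) :
    ∀ᵐ x, ⟪ContinuousLinearMap.adjoint A u x, φ x⟫_ℂ = ⟪u x, A φ x⟫_ℂ := by
  have h1 := L2.integrable_inner (𝕜 := ℂ) (ContinuousLinearMap.adjoint A u) φ
  have h2 := L2.integrable_inner (𝕜 := ℂ) u (A φ)
  have hw : ∀ (p : ι → ℝ) (a b : L2 ι), ∫ x, Complex.exp (Complex.I * (p ⬝ᵥ x : ℝ)) *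
      ⟪a x, b x⟫_ℂ = ⟪a, weyl (Sum.elim 0 p) b⟫_ℂ := by
    intro p a b
    rw [L2.inner_def]
    refine integral_congr_ae ?_
    filter_upwards [coeFn_weyl (Sum.elim 0 p) b] with x hx
    simp only [hx, Sum.elim_comp_inl, Sum.elim_comp_inr, RCLike.inner_apply, sub_zero]
    simp
    ring
  have h0 := ae_eq_zero_of_integral_exp (h1.sub h2) fun p => by
    simp only [Pi.sub_apply, mul_sub]
    rw [integral_sub (integrable_exp_mul p h1) (integrable_exp_mul p h2), hw, hw,
      ContinuousLinearMap.adjoint_inner_left, sub_eq_zero]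
    exact congrArg _ (congrArg (fun T => T φ) (hA (Sum.elim 0 p)))
  filter_upwards [h0] with x hx
  exact sub_eq_zero.1 hx

/-- A translation invariant measurable function is almost everywhere constant. -/
theorem ae_const_of_translation_invariant {m : (ι → ℝ) → ℂ} (hm : Measurable m)
    (h : ∀ q : ι → ℝ, ∀ᵐ x, m (x - q) = m x) : ∃ c, ∀ᵐ x, m x = c := by
  -- The exceptional null set depends on q. Fubini exchanges the quantifiers, so a single x
  -- satisfies m (x - q) = m x for almost every q, and the substitution q = x - y finishes.
  have h' := (Measure.ae_ae_comm (μ := (volume : Measure (ι → ℝ)))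
    (ν := (volume : Measure (ι → ℝ))) (p := fun q x => m (x - q) = m x)
    (measurableSet_eq_fun (hm.comp (measurable_snd.sub measurable_fst))
      (hm.comp measurable_snd))).1 (Filter.Eventually.of_forall h)
  obtain ⟨x, hx⟩ := h'.exists
  refine ⟨m x, ?_⟩
  filter_upwards [(Measure.measurePreserving_sub_left volume x).quasiMeasurePreserving.ae hx] with y hy
  rwa [sub_sub_cancel] at hy

/-- The Weyl representation is irreducible. -/
theorem exists_eq_smul_id_of_commute_weyl {A : L2 ι →L[ℂ] L2 ι}
    (hA : ∀ w, A ∘L weyl w = weyl w ∘L A) : ∃ c : ℂ, A = c • ContinuousLinearMap.id ℂ (L2 ι) := by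
  set G : (ι → ℝ) → ℂ := fun x => Complex.exp (-(1 / 2) * ∑ i, (x i : ℂ) ^ 2) with hG
  have hGc : Measurable G := Continuous.measurable (by fun_prop)
  have hG0 : ∀ x, G x ≠ 0 := fun x => Complex.exp_ne_zero _
  have hGconj : ∀ x, (starRingEnd ℂ) (G x) = G x := by
    intro x
    simp [hG, ← Complex.exp_conj, map_ofNat (starRingEnd ℂ) 2]
  -- The multiplier is read off from the Gaussian, which is nowhere zero: pairing it with φ and with
  -- itself eliminates the adjoint of A.
  have hmul : ∀ φ : L2 ι, ∀ᵐ x, A φ x = A (gauss ι) x / G x * φ x := by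
    intro φ
    filter_upwards [ae_mul_eq_of_commute_weyl hA (gauss ι) φ,
      ae_mul_eq_of_commute_weyl hA (gauss ι) (gauss ι), coeFn_gauss ι] with x h1 h2 h3
    have h3 : gauss ι x = G x := h3
    simp only [RCLike.inner_apply, h3, hGconj] at h1 h2
    rw [mul_comm, mul_right_cancel₀ (hG0 x) ((mul_comm _ _).trans h2)] at h1
    field_simp [hG0 x]
    exact h1.symm
  obtain ⟨c, hc⟩ := ae_const_of_translation_invariant (m := fun x => A (gauss ι) x / G x)
    ((Lp.stronglyMeasurable (A (gauss ι))).measurable.div hGc) fun q => by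
    have hq := (measurePreserving_sub_right (volume : Measure (ι → ℝ))
      q).quasiMeasurePreserving.ae (coeFn_gauss ι)
    -- On the translated Gaussian, A gives both the multiplier at x times G (x - q) and the
    -- translate of `A (gauss ι)`. Dividing by G (x - q) shows that the multiplier is translation
    -- invariant.
    have h4 : A (weyl (Sum.elim q 0) (gauss ι)) = weyl (Sum.elim q 0) (A (gauss ι)) :=
      congrArg (fun T => T (gauss ι)) (hA (Sum.elim q 0))
    have h5 := hmul (weyl (Sum.elim q 0) (gauss ι))
    rw [h4] at h5
    filter_upwards [h5, hq, coeFn_weyl (Sum.elim q 0) (gauss ι),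
      coeFn_weyl (Sum.elim q 0) (A (gauss ι))] with x h1 h2 h3 h4
    have h2 : gauss ι (x - q) = G (x - q) := h2
    simp only [Sum.elim_comp_inl, Sum.elim_comp_inr, dotProduct_zero, zero_dotProduct,
      Complex.ofReal_zero, mul_zero, Complex.exp_zero, one_mul] at h3 h4
    rw [h3, h4, h2] at h1
    rw [h1, mul_div_cancel_right₀ _ (hG0 _)]
  refine ⟨c, ?_⟩
  ext1 φ
  refine Lp.ext ?_
  filter_upwards [hmul φ, hc, Lp.coeFn_smul c φ] with x h1 h2 h3
  refine h1.trans ?_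
  rw [h2]
  exact h3.symm

end Irreducibility

/-! ### Exchange phases and nondegeneracy of the symplectic form -/

section WeylSwap

variable {ι : Type*} [Fintype ι]

theorem weyl_swap (a b : ι ⊕ ι → ℝ) :
    weyl a ∘L weyl b = Complex.exp (-Complex.I * (symp a b : ℝ)) • (weyl b ∘L weyl a) := by
  rw [weyl_comp, weyl_comp, smul_smul, ← Complex.exp_add, symp_swap a b, add_comm b a]
  congr 2
  push_cast
  ring

/-- The phase space rotation `(q, p) ↦ (p, -q)`. -/
def rot (b : ι ⊕ ι → ℝ) : ι ⊕ ι → ℝ :=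
  Sum.elim (fun i => b (Sum.inr i)) (fun i => -b (Sum.inl i))

theorem symp_rot (b z : ι ⊕ ι → ℝ) : symp (rot b) z = b ⬝ᵥ z := by
  simp only [symp, rot, Sum.elim_inl, Sum.elim_inr, dotProduct, Fintype.sum_sum_type,
    Function.comp_apply, mul_neg, Finset.sum_neg_distrib]
  rw [sub_neg_eq_add, add_comm]
  congr 1
  exact Finset.sum_congr rfl fun i _ => mul_comm _ _

end WeylSwap

/-! ### The product phase space and its symplectic form -/

section ProductPhaseSpace

variable {N m : ℕ}

/-- The phase space `(ℝ^{2N})^m`, reordered as `ℝ^{mN} × ℝ^{mN}`. -/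
def flat (z : Fin m × (Fin N ⊕ Fin N) → ℝ) : (Fin m × Fin N) ⊕ (Fin m × Fin N) → ℝ :=
  Sum.elim (fun a => z (a.1, Sum.inl a.2)) (fun a => z (a.1, Sum.inr a.2))

theorem weylPow_eq_weyl_flat (z : Fin m × (Fin N ⊕ Fin N) → ℝ) : weylPow z = weyl (flat z) := rfl

theorem flat_add (a b : Fin m × (Fin N ⊕ Fin N) → ℝ) : flat (a + b) = flat a + flat b := by
  ext (i | i) <;> rfl

theorem flat_neg (a : Fin m × (Fin N ⊕ Fin N) → ℝ) : flat (-a) = -flat a := by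
  ext (i | i) <;> rfl

theorem flat_zero : flat (0 : Fin m × (Fin N ⊕ Fin N) → ℝ) = 0 := by
  ext (i | i) <;> rfl

theorem flat_surjective : Function.Surjective (flat (N := N) (m := m)) := by
  intro y
  refine ⟨fun a => Sum.elim (fun j => y (Sum.inl (a.1, j))) (fun j => y (Sum.inr (a.1, j))) a.2, ?_⟩
  ext (i | i) <;> rfl

theorem flat_dotProduct_flat (a b : Fin m × (Fin N ⊕ Fin N) → ℝ) :
    flat a ⬝ᵥ flat b = a ⬝ᵥ b := by
  simp only [dotProduct, flat, Fintype.sum_sum_type, Fintype.sum_prod_type, Sum.elim_inl,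
    Sum.elim_inr, Finset.sum_add_distrib]

theorem adjoint_weylPow (z : Fin m × (Fin N ⊕ Fin N) → ℝ) :
    ContinuousLinearMap.adjoint (weylPow z) = weylPow (-z) := by
  rw [weylPow_eq_weyl_flat, adjoint_weyl, ← flat_neg, weylPow_eq_weyl_flat]

theorem weylPow_zero :
    weylPow (0 : Fin m × (Fin N ⊕ Fin N) → ℝ) = ContinuousLinearMap.id ℂ (L2Pow N m) := by
  rw [weylPow_eq_weyl_flat, flat_zero, weyl_zero]

/-- The symplectic form of the product phase space. -/
def sympPow (a b : Fin m × (Fin N ⊕ Fin N) → ℝ) : ℝ := symp (flat a) (flat b)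

theorem weylPow_comp (a b : Fin m × (Fin N ⊕ Fin N) → ℝ) :
    weylPow a ∘L weylPow b =
      Complex.exp (-(Complex.I / 2) * (sympPow a b : ℝ)) • weylPow (a + b) := by
  simp only [weylPow_eq_weyl_flat, weyl_comp, flat_add, sympPow]

theorem weylPow_conj (a b : Fin m × (Fin N ⊕ Fin N) → ℝ) :
    weylPow a ∘L weylPow b ∘L ContinuousLinearMap.adjoint (weylPow a) =
      Complex.exp (-Complex.I * (sympPow a b : ℝ)) • weylPow b :=
  weyl_conj (flat a) (flat b)

/-- Nondegeneracy of the symplectic form. It supplies the displacement that shifts c and the strict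
positivity of output covariance matrices. -/
theorem exists_sympPow_eq_dotProduct (b : Fin m × (Fin N ⊕ Fin N) → ℝ) :
    ∃ a, ∀ z, sympPow a z = b ⬝ᵥ z := by
  obtain ⟨a, ha⟩ := flat_surjective (rot (flat b))
  exact ⟨a, fun z => by rw [sympPow, ha, symp_rot, flat_dotProduct_flat]⟩

/-- The sum of the components of a point of the product phase space. -/
def sumComp (z : Fin m × (Fin N ⊕ Fin N) → ℝ) : Fin N ⊕ Fin N → ℝ :=
  (diagMat N m).transpose.mulVec z

theorem sumComp_apply (z : Fin m × (Fin N ⊕ Fin N) → ℝ) (s : Fin N ⊕ Fin N) :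
    sumComp z s = ∑ k, z (k, s) := by
  simp only [sumComp, Matrix.mulVec, dotProduct, diagMat, Matrix.transpose_apply,
    Matrix.submatrix_apply, id, Fintype.sum_prod_type, Matrix.one_apply, ite_mul, one_mul, zero_mul]
  refine Finset.sum_congr rfl fun k _ => ?_
  simp

theorem sumComp_add (a b : Fin m × (Fin N ⊕ Fin N) → ℝ) :
    sumComp (a + b) = sumComp a + sumComp b := Matrix.mulVec_add _ _ _

theorem sumComp_neg (a : Fin m × (Fin N ⊕ Fin N) → ℝ) : sumComp (-a) = -sumComp a :=
  Matrix.mulVec_neg _ _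

theorem sumComp_zero : sumComp (0 : Fin m × (Fin N ⊕ Fin N) → ℝ) = 0 := Matrix.mulVec_zero _

theorem sympPow_diag_left (w : Fin N ⊕ Fin N → ℝ) (z : Fin m × (Fin N ⊕ Fin N) → ℝ) :
    sympPow (fun a => w a.2) z = symp w (sumComp z) := by
  simp only [sympPow, symp, flat, dotProduct, Function.comp_apply, Sum.elim_inl, Sum.elim_inr,
    sumComp_apply, Fintype.sum_prod_type]
  congr 1
  · rw [Finset.sum_comm]
    simp only [Finset.mul_sum]
  · rw [Finset.sum_comm]
    simp only [Finset.sum_mul]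

/-- The symplectic matrix in the off-diagonal blocks, and zero in the diagonal blocks. -/
def offOmega (N m : ℕ) : Matrix (Fin m × (Fin N ⊕ Fin N)) (Fin m × (Fin N ⊕ Fin N)) ℝ :=
  Matrix.of fun a b => if a.1 = b.1 then 0 else Omega N a.2 b.2

theorem blockMat_apply (B : Matrix (Fin m × (Fin N ⊕ Fin N)) (Fin m × (Fin N ⊕ Fin N)) ℝ)
    (a b : Fin m × (Fin N ⊕ Fin N)) :
    blockMat B a b = (B a b : ℂ) - Complex.I * (offOmega N m a b : ℂ) := by
  simp only [blockMat, offOmega, Matrix.of_apply]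
  split_ifs <;> simp

theorem symp_eq_dotProduct_mulVec (a b : Fin N ⊕ Fin N → ℝ) :
    symp a b = a ⬝ᵥ (Omega N).mulVec b := by
  simp only [symp, Omega, Matrix.fromBlocks_mulVec, dotProduct, Fintype.sum_sum_type,
    Sum.elim_inl, Sum.elim_inr, Function.comp_apply, Matrix.zero_mulVec, Matrix.one_mulVec,
    Matrix.neg_mulVec, Pi.neg_apply, zero_add, add_zero, mul_neg,
    Finset.sum_neg_distrib, sub_eq_add_neg]
  congr 2
  exact Finset.sum_congr rfl fun i _ => mul_comm _ _

theorem sympPow_eq_sum (a b : Fin m × (Fin N ⊕ Fin N) → ℝ) :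
    sympPow a b = ∑ k, symp (component a k) (component b k) := by
  simp only [sympPow, symp, flat, dotProduct, Function.comp_apply, Sum.elim_inl, Sum.elim_inr,
    component, Fintype.sum_prod_type, Finset.sum_sub_distrib]

/-- Filling all m × m blocks with Ω gives the form of the summed components, and the diagonal blocks
account for the product form. The off-diagonal blocks thus measure the mismatch between output and
input commutation phases. -/
theorem dotProduct_offOmega_mulVec (a b : Fin m × (Fin N ⊕ Fin N) → ℝ) :
    a ⬝ᵥ (offOmega N m).mulVec b = symp (sumComp a) (sumComp b) - sympPow a b := by
  have h1 : symp (sumComp a) (sumComp b) = ∑ k, symp (component a k) (sumComp b) := by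
    simp only [symp_eq_dotProduct_mulVec, dotProduct, sumComp_apply a, Finset.sum_mul, component]
    exact Finset.sum_comm
  rw [h1, sympPow_eq_sum, ← Finset.sum_sub_distrib, dotProduct, Fintype.sum_prod_type]
  refine Finset.sum_congr rfl fun k _ => ?_
  rw [symp_eq_dotProduct_mulVec, symp_eq_dotProduct_mulVec, ← dotProduct_sub, ← Matrix.mulVec_sub]
  refine Finset.sum_congr rfl fun s _ => ?_
  simp only [component, Matrix.mulVec, dotProduct, offOmega, Matrix.of_apply, Pi.sub_apply,
    sumComp_apply]
  congr 1
  rw [Fintype.sum_prod_type_right]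
  refine Finset.sum_congr rfl fun t _ => ?_
  rw [← Finset.sum_erase_add _ _ (Finset.mem_univ k), ← Finset.sum_erase_add _ _ (Finset.mem_univ k)]
  simp only [if_true, zero_mul, add_zero, add_sub_cancel_right, Finset.mul_sum]
  exact Finset.sum_congr rfl fun l hl => by rw [if_neg (Finset.ne_of_mem_erase hl).symm]

end ProductPhaseSpace

/-! ### Covariant maps on Weyl operators, and complete positivity -/

section Covariance

variable {N m : ℕ} {Ψ : (L2Pow N m →L[ℂ] L2Pow N m) →ₗ[ℂ] (L2 (Fin N) →L[ℂ] L2 (Fin N))}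

/-- The operator P W(-u) commutes with every Weyl operator because the two phases cancel, so
irreducibility makes it a scalar. -/
theorem exists_eq_smul_weyl {ι : Type*} [Fintype ι] {P : L2 ι →L[ℂ] L2 ι} {u : ι ⊕ ι → ℝ}
    (hc : ∀ w, weyl w ∘L P = Complex.exp (-Complex.I * (symp w u : ℝ)) • (P ∘L weyl w)) :
    ∃ c : ℂ, P = c • weyl u := by
  obtain ⟨c, hA⟩ := exists_eq_smul_id_of_commute_weyl (A := P ∘L weyl (-u)) fun w => by
    rw [← ContinuousLinearMap.comp_assoc, hc w, ContinuousLinearMap.smul_comp,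
      ContinuousLinearMap.comp_assoc, ContinuousLinearMap.comp_assoc, weyl_swap w,
      ContinuousLinearMap.comp_smul, smul_smul, ← Complex.exp_add, symp_neg_right]
    simp
  refine ⟨c, ?_⟩
  rw [← ContinuousLinearMap.comp_id P, ← weyl_neg_comp u, ← ContinuousLinearMap.comp_assoc, hA,
    ContinuousLinearMap.smul_comp, ContinuousLinearMap.id_comp]

theorem IsCovariant.weyl_comp_eq (hcov : IsCovariant weyl (weylDiag N m) Ψ)
    (z : Fin m × (Fin N ⊕ Fin N) → ℝ) (w : Fin N ⊕ Fin N → ℝ) :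
    weyl w ∘L Ψ (weylPow z) =
      Complex.exp (-Complex.I * (symp w (sumComp z) : ℝ)) • (Ψ (weylPow z) ∘L weyl w) := by
  have hd : weylDiag N m w ∘L weylPow z ∘L ContinuousLinearMap.adjoint (weylDiag N m w) =
      Complex.exp (-Complex.I * (symp w (sumComp z) : ℝ)) • weylPow z := by
    rw [← sympPow_diag_left, weylDiag]
    exact weylPow_conj _ _
  have h := hcov w (weylPow z)
  rw [hd, LinearMap.map_smul Ψ, adjoint_weyl] at h
  have h' : (weyl w ∘L Ψ (weylPow z) ∘L weyl (-w)) ∘L weyl w = _ := congrArg (· ∘L weyl w) h.symm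
  rw [ContinuousLinearMap.comp_assoc, ContinuousLinearMap.comp_assoc, weyl_neg_comp,
    ContinuousLinearMap.comp_id] at h'
  exact h'

/-- A covariant map sends Weyl operators to multiples of Weyl operators. -/
theorem IsCovariant.exists_weylPow_eq (hcov : IsCovariant weyl (weylDiag N m) Ψ) :
    ∃ f : (Fin m × (Fin N ⊕ Fin N) → ℝ) → ℂ, ∀ z, Ψ (weylPow z) = f z • weyl (sumComp z) :=
  Classical.axiom_of_choice fun z => exists_eq_smul_weyl (hcov.weyl_comp_eq z)

theorem inner_gauss_self (ι : Type*) [Fintype ι] :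
    ⟪gauss ι, gauss ι⟫_ℂ = (Real.pi ^ (Fintype.card ι / 2 : ℝ) : ℝ) := by
  have h := inner_gauss_weyl_gauss (0 : ι ⊕ ι → ℝ)
  rw [weyl_zero] at h
  simpa only [ContinuousLinearMap.id_apply, dotProduct_zero, Complex.ofReal_zero, mul_zero,
    Complex.exp_zero, mul_one] using h

/-- Complete positivity, tested on Weyl operators. -/
theorem IsCompletelyPositive.kernel_nonneg (hΨ : IsCompletelyPositive Ψ)
    {f : (Fin m × (Fin N ⊕ Fin N) → ℝ) → ℂ} (hf : ∀ z, Ψ (weylPow z) = f z • weyl (sumComp z))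
    {α : Type*} [Fintype α] (z : α → Fin m × (Fin N ⊕ Fin N) → ℝ) (c : α → ℂ) :
    0 ≤ ∑ i, ∑ j, starRingEnd ℂ (c i) * c j * (f (z j - z i) *
      Complex.exp (-(Complex.I / 2) * (z i ⬝ᵥ (offOmega N m).mulVec (z j) : ℝ))) := by
  let e := Fintype.equivFin α
  -- The test vectors undo the Weyl operators W(J_mᵀ z_i): each matrix element collapses to a phase
  -- times the squared norm of the Gaussian vector, which is divided out at the end.
  have h := hΨ (Fintype.card α) (fun i => weylPow (z (e.symm i)))
    (fun i => c (e.symm i) • weyl (-sumComp (z (e.symm i))) (gauss (Fin N)))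
  have hterm : ∀ i j : α, ⟪c i • weyl (-sumComp (z i)) (gauss (Fin N)),
      Ψ (ContinuousLinearMap.adjoint (weylPow (z i)) ∘L weylPow (z j))
        (c j • weyl (-sumComp (z j)) (gauss (Fin N)))⟫_ℂ =
      ⟪gauss (Fin N), gauss (Fin N)⟫_ℂ * (starRingEnd ℂ (c i) * c j * (f (z j - z i) *
      Complex.exp (-(Complex.I / 2) * (z i ⬝ᵥ (offOmega N m).mulVec (z j) : ℝ)))) := by
    intro i j
    rw [adjoint_weylPow, weylPow_comp, LinearMap.map_smul Ψ, neg_add_eq_sub, hf, ← adjoint_weyl,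
      inner_smul_left, ContinuousLinearMap.adjoint_inner_left]
    have hW : weyl (sumComp (z i)) ∘L weyl (sumComp (z j - z i)) ∘L weyl (-sumComp (z j)) =
        Complex.exp (-(Complex.I / 2) * (symp (sumComp (z i)) (sumComp (z j)) : ℝ)) •
          ContinuousLinearMap.id ℂ (L2 (Fin N)) := by
      rw [← ContinuousLinearMap.comp_assoc, weyl_comp, ← sumComp_add, add_sub_cancel,
        ContinuousLinearMap.smul_comp, weyl_comp_neg, sub_eq_add_neg, sumComp_add, sumComp_neg,
        symp_add_right, symp_neg_right, symp_self, neg_zero, add_zero]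
    have hW' := congrArg (fun T => T (gauss (Fin N))) hW
    simp only [ContinuousLinearMap.comp_apply, _root_.smul_apply,
      ContinuousLinearMap.id_apply] at hW'
    simp only [_root_.smul_apply, map_smul, hW', inner_smul_right]
    rw [dotProduct_offOmega_mulVec, sympPow, sympPow, flat_neg, symp_neg_left]
    have : Complex.exp (-(Complex.I / 2) *
        ((symp (sumComp (z i)) (sumComp (z j)) - symp (flat (z i)) (flat (z j)) : ℝ))) =
        Complex.exp (-(Complex.I / 2) * ((-symp (flat (z i)) (flat (z j)) : ℝ))) *
        Complex.exp (-(Complex.I / 2) * (symp (sumComp (z i)) (sumComp (z j)) : ℝ)) := by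
      rw [← Complex.exp_add]
      congr 1
      push_cast
      ring
    rw [this]
    ring
  simp only [hterm, ← Finset.mul_sum] at h
  rw [e.symm.sum_comp (fun i => ∑ j, (starRingEnd ℂ (c i) * c (e.symm j) *
    (f (z (e.symm j) - z i) * Complex.exp (-(Complex.I / 2) *
      (z i ⬝ᵥ (offOmega N m).mulVec (z (e.symm j)) : ℝ)))))] at h
  simp only [fun i => e.symm.sum_comp (fun j => (starRingEnd ℂ (c i) * c j *
    (f (z j - z i) * Complex.exp (-(Complex.I / 2) *
      (z i ⬝ᵥ (offOmega N m).mulVec (z j) : ℝ)))))] at h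
  rw [inner_gauss_self] at h
  have hr := Real.rpow_pos_of_pos Real.pi_pos (Fintype.card (Fin N) / 2 : ℝ)
  set r := Real.pi ^ (Fintype.card (Fin N) / 2 : ℝ)
  have h' := mul_nonneg (Complex.zero_le_real.2 (inv_pos.2 hr).le) h
  rwa [← mul_assoc, ← Complex.ofReal_mul, inv_mul_cancel₀ hr.ne', Complex.ofReal_one,
    one_mul] at h'

end Covariance

/-! ### From positive kernels to positive matrices -/

section MatrixPositivity

variable {N m : ℕ} {B : Matrix (Fin m × (Fin N ⊕ Fin N)) (Fin m × (Fin N ⊕ Fin N)) ℝ}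

theorem isHermitian_blockMat (hB : B.IsSymm) : (blockMat B).IsHermitian := by
  refine Matrix.IsHermitian.ext fun a b => ?_
  have h1 : B b a = B a b := hB.apply a b
  have h2 : offOmega N m b a = -offOmega N m a b := by
    simp only [offOmega, Matrix.of_apply, eq_comm (a := b.1)]
    split_ifs
    · simp
    · rcases a with ⟨k, s | s⟩ <;> rcases b with ⟨l, t | t⟩ <;>
        simp [Omega, Matrix.one_apply, eq_comm]
  rw [blockMat_apply, blockMat_apply, h1, h2]
  simp [sub_eq_add_neg]

/-- A matrix `M` is positive semidefinite if the kernels `exp(s M)` are, for all `s > 0`. -/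
theorem posSemidef_of_exp_kernel {κ : Type*} [Fintype κ] {M : Matrix κ κ ℂ} (hM : M.IsHermitian)
    (h : ∀ s : ℝ, 0 < s → ∀ d : κ → ℂ,
      0 ≤ ∑ a, ∑ b, starRingEnd ℂ (d a) * d b * (Complex.exp (s * M a b) - 1)) :
    M.PosSemidef := by
  refine Matrix.PosSemidef.of_dotProduct_mulVec_nonneg hM fun d => ?_
  -- M is the entrywise derivative of exp(sM) at s = 0, so its quadratic form is a limit of
  -- nonnegative difference quotients.
  have hlim : Filter.Tendsto (fun s : ℝ => ∑ a, ∑ b, starRingEnd ℂ (d a) * d b *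
      ((s : ℂ)⁻¹ * (Complex.exp (s * M a b) - 1))) (nhdsWithin 0 (Set.Ioi 0))
      (nhds (∑ a, ∑ b, starRingEnd ℂ (d a) * d b * M a b)) := by
    refine tendsto_finsetSum _ fun a _ => tendsto_finsetSum _ fun b _ =>
      Filter.Tendsto.const_mul _ ?_
    have hd : HasDerivAt (fun s : ℝ => Complex.exp (s * M a b)) (M a b) 0 := by
      have := ((Complex.ofRealCLM.hasDerivAt (x := (0 : ℝ))).mul_const (M a b)).cexp
      simpa using this
    refine ((hasDerivAt_iff_tendsto_slope_zero.1 hd).mono_left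
      (nhdsWithin_mono _ fun x hx => ne_of_gt hx)).congr fun s => ?_
    simp
  have hsum : star d ⬝ᵥ M.mulVec d = ∑ a, ∑ b, starRingEnd ℂ (d a) * d b * M a b := by
    simp only [dotProduct, Matrix.mulVec, Finset.mul_sum, Pi.star_apply]
    refine Finset.sum_congr rfl fun a _ => Finset.sum_congr rfl fun b _ => ?_
    rw [Complex.star_def]
    ring
  rw [hsum]
  refine ge_of_tendsto hlim ?_
  filter_upwards [self_mem_nhdsWithin] with s hs
  have h1 := mul_nonneg (Complex.zero_le_real.2 (inv_pos.2 (Set.mem_Ioi.1 hs)).le) (h s hs d)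
  simp only [Finset.mul_sum, Complex.ofReal_inv] at h1
  refine h1.trans_eq ?_
  refine Finset.sum_congr rfl fun a _ => Finset.sum_congr rfl fun b _ => ?_
  ring

theorem posSemidef_blockMat_of_kernel_nonneg (hB : B.IsSymm)
    (h : ∀ (z : Option (Fin m × (Fin N ⊕ Fin N)) → Fin m × (Fin N ⊕ Fin N) → ℝ)
      (d : Option (Fin m × (Fin N ⊕ Fin N)) → ℂ),
      0 ≤ ∑ i, ∑ j, starRingEnd ℂ (d i) * d j *
        Complex.exp (1 / 2 * ((z i ⬝ᵥ B.mulVec (z j) : ℝ) -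
          Complex.I * (z i ⬝ᵥ (offOmega N m).mulVec (z j) : ℝ)))) :
    (blockMat B).PosSemidef := by
  refine posSemidef_of_exp_kernel (isHermitian_blockMat hB) fun s hs d => ?_
  -- The scaling √(2s) turns the factor 1/2 in the exponent into s. The extra point at the origin,
  -- weighted so that all coefficients sum to zero, produces the -1 of the difference quotient.
  have h1 := h (fun i => i.elim 0 fun a => Pi.single a (√(2 * s)))
    (fun i => i.elim (-∑ a, d a) d)
  have hs' : √(2 * s) * √(2 * s) = 2 * s := Real.mul_self_sqrt (by positivity)
  have hquad : ∀ (A : Matrix (Fin m × (Fin N ⊕ Fin N)) (Fin m × (Fin N ⊕ Fin N)) ℝ) (a b),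
      (Pi.single a (√(2 * s)) : Fin m × (Fin N ⊕ Fin N) → ℝ) ⬝ᵥ
        A.mulVec (Pi.single b (√(2 * s))) = 2 * s * A a b := by
    intro A a b
    rw [single_dotProduct, Matrix.mulVec_single, ← hs']
    simp
    ring
  simp only [Fintype.sum_option, Option.elim_none, Option.elim_some, hquad, zero_dotProduct,
    Matrix.mulVec_zero, dotProduct_zero, Complex.ofReal_zero, mul_zero, sub_zero, Complex.exp_zero,
    mul_one, map_neg, map_sum] at h1
  refine h1.trans_eq ?_
  have hexp : ∀ a b, Complex.exp (1 / 2 * (((2 * s * B a b : ℝ) : ℂ) -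
      Complex.I * ((2 * s * offOmega N m a b : ℝ) : ℂ))) = Complex.exp (s * blockMat B a b) := by
    intro a b
    rw [blockMat_apply]
    congr 1
    push_cast
    ring
  simp only [hexp]
  simp only [mul_sub, mul_one, Finset.sum_sub_distrib, Finset.sum_add_distrib,
    ← Finset.mul_sum, ← Finset.sum_mul]
  ring

theorem blockMat_mulVec_ofReal (B : Matrix (Fin m × (Fin N ⊕ Fin N)) (Fin m × (Fin N ⊕ Fin N)) ℝ)
    (z : Fin m × (Fin N ⊕ Fin N) → ℝ) (a : Fin m × (Fin N ⊕ Fin N)) :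
    (blockMat B).mulVec (fun b => (z b : ℂ)) a =
      (B.mulVec z a : ℂ) - Complex.I * ((offOmega N m).mulVec z a : ℂ) := by
  simp only [Matrix.mulVec, dotProduct, blockMat_apply, sub_mul, Finset.sum_sub_distrib,
    mul_assoc]
  push_cast
  simp only [Finset.mul_sum]

theorem star_dotProduct_blockMat_mulVec_ofReal
    (B : Matrix (Fin m × (Fin N ⊕ Fin N)) (Fin m × (Fin N ⊕ Fin N)) ℝ)
    (z : Fin m × (Fin N ⊕ Fin N) → ℝ) :
    star (fun b => (z b : ℂ)) ⬝ᵥ (blockMat B).mulVec (fun b => (z b : ℂ)) =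
      (z ⬝ᵥ B.mulVec z : ℝ) := by
  have h0 : z ⬝ᵥ (offOmega N m).mulVec z = 0 := by
    rw [dotProduct_offOmega_mulVec, symp_self, sympPow, symp_self, sub_zero]
  have h1 : star (fun b => (z b : ℂ)) ⬝ᵥ (blockMat B).mulVec (fun b => (z b : ℂ)) =
      (z ⬝ᵥ B.mulVec z : ℝ) - Complex.I * (z ⬝ᵥ (offOmega N m).mulVec z : ℝ) := by
    simp only [dotProduct, blockMat_mulVec_ofReal, Pi.star_apply, Complex.star_def,
      Complex.conj_ofReal]
    push_cast
    rw [Finset.mul_sum, ← Finset.sum_sub_distrib]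
    exact Finset.sum_congr rfl fun a _ => by ring
  rw [h1, h0]
  simp

theorem dotProduct_diagMat_mulVec (z : Fin m × (Fin N ⊕ Fin N) → ℝ) (v : Fin N ⊕ Fin N → ℝ) :
    z ⬝ᵥ (diagMat N m).mulVec v = sumComp z ⬝ᵥ v := by
  rw [Matrix.dotProduct_mulVec, ← Matrix.mulVec_transpose, sumComp]

/-- The covariance matrix of the output of a Gaussian channel is positive definite. -/
theorem posDef_add_diagMat_mul (hB : B.IsSymm) (hpos : (blockMat B).PosSemidef)
    {V : Matrix (Fin N ⊕ Fin N) (Fin N ⊕ Fin N) ℝ} (hV : V.PosDef) :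
    (B + diagMat N m * V * (diagMat N m).transpose).PosDef := by
  have hquad : ∀ z : Fin m × (Fin N ⊕ Fin N) → ℝ,
      z ⬝ᵥ (diagMat N m * V * (diagMat N m).transpose).mulVec z =
        sumComp z ⬝ᵥ V.mulVec (sumComp z) := by
    intro z
    rw [← Matrix.mulVec_mulVec, ← Matrix.mulVec_mulVec, dotProduct_diagMat_mulVec]
    rfl
  refine Matrix.PosDef.of_dotProduct_mulVec_pos ?_ fun z hz => ?_
  · refine Matrix.IsHermitian.add ?_ ?_
    · rw [Matrix.IsHermitian, Matrix.conjTranspose_eq_transpose_of_trivial]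
      exact hB
    · simpa using Matrix.isHermitian_mul_mul_conjTranspose (diagMat N m) hV.isHermitian
  rw [star_trivial, Matrix.add_mulVec, dotProduct_add, hquad]
  have hBz : 0 ≤ z ⬝ᵥ B.mulVec z := by
    have := hpos.dotProduct_mulVec_nonneg (fun b => (z b : ℂ))
    rw [star_dotProduct_blockMat_mulVec_ofReal] at this
    exact_mod_cast this
  by_cases hJ : sumComp z = 0
  · rw [hJ, zero_dotProduct, add_zero]
    -- A null vector of a positive semidefinite form lies in the kernel of its matrix. For real z
    -- the imaginary part of that equation says that the off-diagonal symplectic matrix kills z.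
    refine hBz.lt_of_ne fun h0 => hz ?_
    have h1 := (hpos.dotProduct_mulVec_zero_iff (fun b => (z b : ℂ))).1 (by
      rw [star_dotProduct_blockMat_mulVec_ofReal, ← h0, Complex.ofReal_zero])
    have h2 : (offOmega N m).mulVec z = 0 := by
      ext a
      have := congrArg Complex.im (congrFun h1 a)
      rw [blockMat_mulVec_ofReal] at this
      simpa using this
    -- Since the components of z sum to zero, z is now symplectically orthogonal to every vector.
    -- Pairing with the y that represents z itself gives z ⬝ᵥ z = 0.
    obtain ⟨y, hy⟩ := exists_sympPow_eq_dotProduct z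
    have h3 := dotProduct_offOmega_mulVec y z
    rw [h2, hJ, dotProduct_zero, symp_swap 0, ← symp_neg_left, neg_zero, hy] at h3
    have h4 : symp 0 (sumComp y) = 0 := by simp [symp, dotProduct]
    rw [h4] at h3
    exact dotProduct_self_eq_zero.1 (by linarith)
  · have := hV.dotProduct_mulVec_pos hJ
    rw [star_trivial] at this
    linarith

end MatrixPositivity

/-! ### Gaussian channels and their Gaussian form -/

section GaussianForm

variable {N m : ℕ} {Ψ : (L2Pow N m →L[ℂ] L2Pow N m) →ₗ[ℂ] (L2 (Fin N) →L[ℂ] L2 (Fin N))}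
  {B : Matrix (Fin m × (Fin N ⊕ Fin N)) (Fin m × (Fin N ⊕ Fin N)) ℝ}
  {c : Fin m × (Fin N ⊕ Fin N) → ℝ}

theorem trace_smul {H : Type*} [NormedAddCommGroup H] [InnerProductSpace ℂ H] [CompleteSpace H]
    (r : ℂ) (T : H →L[ℂ] H) : trace (r • T) = r * trace T := by
  simp only [trace, _root_.smul_apply, inner_smul_right, tsum_mul_left]

/-- Parseval in the fixed basis, so no basis independence of the trace is needed for the single test
state. -/
theorem trace_rankOne_comp {H : Type*} [NormedAddCommGroup H] [InnerProductSpace ℂ H]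
    [CompleteSpace H] (g : H) (T : H →L[ℂ] H) :
    trace (InnerProductSpace.rankOne ℂ g g ∘L T) = ⟪g, T g⟫_ℂ := by
  rw [← ContinuousLinearMap.adjoint_inner_left, ← (stdBasis H).tsum_inner_mul_inner, trace]
  refine tsum_congr fun i => ?_
  rw [ContinuousLinearMap.comp_apply, InnerProductSpace.rankOne_apply, inner_smul_right,
    ContinuousLinearMap.adjoint_inner_left]

theorem isPositiveTraceClass_rankOne {H : Type*} [NormedAddCommGroup H] [InnerProductSpace ℂ H]
    [CompleteSpace H] (g : H) : IsPositiveTraceClass (InnerProductSpace.rankOne ℂ g g) := by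
  refine ⟨InnerProductSpace.isPositive_rankOne_self g, ?_⟩
  refine ((stdBasis H).summable_inner_mul_inner g g).congr fun i => ?_
  rw [InnerProductSpace.rankOne_apply, inner_smul_right]

theorem fourierPredual_eq {f : (Fin m × (Fin N ⊕ Fin N) → ℝ) → ℂ}
    (hf : ∀ z, Ψ (weylPow z) = f z • weyl (sumComp z)) (S : L2 (Fin N) →L[ℂ] L2 (Fin N))
    (z : Fin m × (Fin N ⊕ Fin N) → ℝ) :
    fourierPredual Ψ S z = f z * fourier S (sumComp z) := by
  rw [fourierPredual, fourier, hf, ContinuousLinearMap.comp_smul, trace_smul]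

/-- The exponents add: V becomes B + J V Jᵀ, d becomes c + J d, and the constant C is unchanged. -/
theorem HasGaussianForm.isGaussianChannel (hB : B.IsSymm) (hpos : (blockMat B).PosSemidef)
    (h : HasGaussianForm Ψ B c) : IsGaussianChannel Ψ := by
  rintro S - ⟨C, V, d, hC, hV, hS⟩
  refine ⟨C, _, c + (diagMat N m).mulVec d, hC, posDef_add_diagMat_mul hB hpos hV, fun z => ?_⟩
  rw [fourierPredual_eq h, hS, mul_left_comm, ← Complex.exp_add]
  have h1 : z ⬝ᵥ (diagMat N m * V * (diagMat N m).transpose).mulVec z =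
      sumComp z ⬝ᵥ V.mulVec (sumComp z) := by
    rw [← Matrix.mulVec_mulVec, ← Matrix.mulVec_mulVec, dotProduct_diagMat_mulVec]
    rfl
  have h2 : (diagMat N m).mulVec d ⬝ᵥ z = d ⬝ᵥ sumComp z := by
    rw [dotProduct_comm, dotProduct_diagMat_mulVec, dotProduct_comm]
  rw [Matrix.add_mulVec, dotProduct_add, add_dotProduct, h1, h2]
  congr 2
  push_cast
  ring

theorem isGaussianFunction_fourier_gauss :
    IsGaussianFunction (fourier (InnerProductSpace.rankOne ℂ (gauss (Fin N)) (gauss (Fin N)))) := by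
  refine ⟨_, 1, 0, Real.rpow_pos_of_pos Real.pi_pos (Fintype.card (Fin N) / 2 : ℝ),
    Matrix.PosDef.one, fun w => ?_⟩
  rw [fourier, trace_rankOne_comp, inner_gauss_weyl_gauss]
  simp

theorem IsGaussianChannel.exists_hasGaussianForm (hΨ : IsChannel Ψ)
    (hcov : IsCovariant weyl (weylDiag N m) Ψ) (hG : IsGaussianChannel Ψ) :
    ∃ B : Matrix (Fin m × (Fin N ⊕ Fin N)) (Fin m × (Fin N ⊕ Fin N)) ℝ,
      B.IsSymm ∧ (blockMat B).PosSemidef ∧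
        ∃ c : Fin m × (Fin N ⊕ Fin N) → ℝ, HasGaussianForm Ψ B c := by
  obtain ⟨f, hf⟩ := hcov.exists_weylPow_eq
  obtain ⟨C, V, d, hC, hV, hS⟩ := hG _ (isPositiveTraceClass_rankOne (gauss (Fin N)))
    isGaussianFunction_fourier_gauss
  have hS' : ∀ z, f z * ((Real.pi ^ (Fintype.card (Fin N) / 2 : ℝ) : ℝ) *
      Complex.exp (-(1 / 4) * (sumComp z ⬝ᵥ sumComp z : ℝ))) = C * Complex.exp
      (-(1 / 4) * (z ⬝ᵥ V.mulVec z : ℝ) - Complex.I * (d ⬝ᵥ z : ℝ)) := by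
    intro z
    rw [← hS, fourierPredual_eq hf, fourier, trace_rankOne_comp, inner_gauss_weyl_gauss]
  have hr := Real.rpow_pos_of_pos Real.pi_pos (Fintype.card (Fin N) / 2 : ℝ)
  set r := Real.pi ^ (Fintype.card (Fin N) / 2 : ℝ)
  -- Unitality normalizes f, which forces C to equal the squared norm of the Gaussian vector; the
  -- two constants then cancel.
  have hf0 : f 0 = 1 := by
    have h := hf 0
    rw [weylPow_zero, hΨ.unital, sumComp_zero, weyl_zero] at h
    have h' := congrArg (fun T => ⟪gauss (Fin N), T (gauss (Fin N))⟫_ℂ) h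
    simp only [_root_.smul_apply, ContinuousLinearMap.id_apply, inner_smul_right,
      inner_gauss_self] at h'
    exact (mul_eq_right₀ (Complex.ofReal_ne_zero.2 hr.ne')).1 h'.symm
  have hCr : (C : ℂ) = r := by
    have h := hS' 0
    rw [hf0, sumComp_zero] at h
    simpa using h.symm
  set B := V - diagMat N m * (diagMat N m).transpose with hBdef
  have hfz : ∀ z, f z =
      Complex.exp (-(1 / 4) * (z ⬝ᵥ B.mulVec z : ℝ) - Complex.I * (d ⬝ᵥ z : ℝ)) := by
    intro z
    have h := hS' z
    have hq : z ⬝ᵥ B.mulVec z = z ⬝ᵥ V.mulVec z - sumComp z ⬝ᵥ sumComp z := by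
      rw [hBdef, Matrix.sub_mulVec, dotProduct_sub, ← Matrix.mulVec_mulVec,
        dotProduct_diagMat_mulVec]
      rfl
    rw [hCr, mul_left_comm] at h
    have h := mul_left_cancel₀ (Complex.ofReal_ne_zero.2 hr.ne') h
    refine mul_right_cancel₀ (Complex.exp_ne_zero _) (h.trans ?_)
    rw [hq, ← Complex.exp_add]
    congr 1
    push_cast
    ring
  have hB : B.IsSymm := by
    have hVs : V.transpose = V := by
      rw [← Matrix.conjTranspose_eq_transpose_of_trivial]; exact hV.isHermitian
    rw [Matrix.IsSymm, hBdef, Matrix.transpose_sub, Matrix.transpose_mul,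
      Matrix.transpose_transpose, hVs]
  refine ⟨B, hB, posSemidef_blockMat_of_kernel_nonneg hB fun z e => ?_, d, fun z => ?_⟩
  -- The extra factors absorb the parts of f (z j - z i) that depend on z i or z j alone, leaving
  -- the cross term exp(½ z_iᵀ B z_j).
  · refine (hΨ.completelyPositive.kernel_nonneg hf z fun i => e i *
      Complex.exp (1 / 4 * (z i ⬝ᵥ B.mulVec (z i) : ℝ) + Complex.I * (d ⬝ᵥ z i : ℝ))).trans_eq ?_
    refine Finset.sum_congr rfl fun i _ => Finset.sum_congr rfl fun j _ => ?_
    have hsymm : z j ⬝ᵥ B.mulVec (z i) = z i ⬝ᵥ B.mulVec (z j) := by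
      rw [Matrix.dotProduct_mulVec, dotProduct_comm, ← Matrix.mulVec_transpose, hB]
    rw [hfz, Matrix.mulVec_sub, sub_dotProduct, dotProduct_sub, dotProduct_sub, dotProduct_sub,
      hsymm, map_mul, ← Complex.exp_conj]
    have hre : starRingEnd ℂ (1 / 4 * (z i ⬝ᵥ B.mulVec (z i) : ℝ) + Complex.I * (d ⬝ᵥ z i : ℝ)) =
        1 / 4 * (z i ⬝ᵥ B.mulVec (z i) : ℝ) - Complex.I * (d ⬝ᵥ z i : ℝ) := by
      simp [map_ofNat (starRingEnd ℂ) 4, sub_eq_add_neg]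
    rw [hre]
    have hexp : Complex.exp (1 / 2 * ((z i ⬝ᵥ B.mulVec (z j) : ℝ) -
          Complex.I * (z i ⬝ᵥ (offOmega N m).mulVec (z j) : ℝ))) =
        Complex.exp (1 / 4 * (z i ⬝ᵥ B.mulVec (z i) : ℝ) - Complex.I * (d ⬝ᵥ z i : ℝ)) *
        Complex.exp (1 / 4 * (z j ⬝ᵥ B.mulVec (z j) : ℝ) + Complex.I * (d ⬝ᵥ z j : ℝ)) *
        Complex.exp (-(1 / 4) * (z j ⬝ᵥ B.mulVec (z j) - z i ⬝ᵥ B.mulVec (z j) -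
          (z i ⬝ᵥ B.mulVec (z j) - z i ⬝ᵥ B.mulVec (z i)) : ℝ) -
          Complex.I * (d ⬝ᵥ z j - d ⬝ᵥ z i : ℝ)) *
        Complex.exp (-(Complex.I / 2) * (z i ⬝ᵥ (offOmega N m).mulVec (z j) : ℝ)) := by
      rw [← Complex.exp_add, ← Complex.exp_add, ← Complex.exp_add]
      congr 1
      push_cast
      ring
    rw [hexp]
    ring
  · rw [hf, hfz]
    rfl

end GaussianForm

/-! ### Shifting c by a displacement -/

section Displacement

variable {N m : ℕ} {Ψ : (L2Pow N m →L[ℂ] L2Pow N m) →ₗ[ℂ] (L2 (Fin N) →L[ℂ] L2 (Fin N))}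

/-- Conjugation by an operator, `X ↦ U X U^*`. -/
def conjBy {K : Type*} [NormedAddCommGroup K] [InnerProductSpace ℂ K] [CompleteSpace K]
    (U : K →L[ℂ] K) : (K →L[ℂ] K) →ₗ[ℂ] (K →L[ℂ] K) where
  toFun X := U ∘L X ∘L ContinuousLinearMap.adjoint U
  map_add' X Y := by rw [ContinuousLinearMap.add_comp, ContinuousLinearMap.comp_add]
  map_smul' r X := by
    rw [ContinuousLinearMap.smul_comp, ContinuousLinearMap.comp_smul, RingHom.id_apply]

section

variable {H K : Type*} [NormedAddCommGroup H] [InnerProductSpace ℂ H] [CompleteSpace H]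
  [NormedAddCommGroup K] [InnerProductSpace ℂ K] [CompleteSpace K]

theorem conjBy_apply (U X : K →L[ℂ] K) :
    conjBy U X = U ∘L X ∘L ContinuousLinearMap.adjoint U := rfl

theorem conjBy_mono (U : K →L[ℂ] K) : Monotone (conjBy U) := by
  intro X Y h
  rw [ContinuousLinearMap.le_def, ← map_sub]
  exact ((ContinuousLinearMap.le_def _ _).1 h).conj_adjoint U

theorem conjBy_conjBy_adjoint {U : K →L[ℂ] K}
    (h : U ∘L ContinuousLinearMap.adjoint U = ContinuousLinearMap.id ℂ K) (X : K →L[ℂ] K) :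
    conjBy U (conjBy (ContinuousLinearMap.adjoint U) X) = X := by
  rw [conjBy_apply, conjBy_apply, ContinuousLinearMap.adjoint_adjoint,
    ContinuousLinearMap.comp_assoc, ContinuousLinearMap.comp_assoc, h, ContinuousLinearMap.comp_id,
    ← ContinuousLinearMap.comp_assoc, h, ContinuousLinearMap.id_comp]

/-- Complete positivity is that of Φ for the operators D_i U^*. Conjugation by a unitary is an order
isomorphism, with inverse the conjugation by U^*, so it preserves suprema of directed sets. -/
theorem IsChannel.comp_conjBy {Φ : (K →L[ℂ] K) →ₗ[ℂ] (H →L[ℂ] H)} (hΦ : IsChannel Φ)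
    {U : K →L[ℂ] K} (h1 : U ∘L ContinuousLinearMap.adjoint U = ContinuousLinearMap.id ℂ K)
    (h2 : ContinuousLinearMap.adjoint U ∘L U = ContinuousLinearMap.id ℂ K) :
    IsChannel (Φ ∘ₗ conjBy U) := by
  have hinv : ∀ X, conjBy (ContinuousLinearMap.adjoint U) (conjBy U X) = X := by
    intro X
    have := conjBy_conjBy_adjoint (U := ContinuousLinearMap.adjoint U)
      (by rwa [ContinuousLinearMap.adjoint_adjoint]) X
    rwa [ContinuousLinearMap.adjoint_adjoint] at this
  refine ⟨fun n D φ => ?_, ?_, ?_⟩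
  · have h := hΦ.completelyPositive n (fun i => D i ∘L ContinuousLinearMap.adjoint U) φ
    simpa only [ContinuousLinearMap.adjoint_comp, ContinuousLinearMap.adjoint_adjoint,
      ContinuousLinearMap.comp_assoc, LinearMap.comp_apply, conjBy_apply] using h
  · rw [LinearMap.comp_apply, conjBy_apply, ContinuousLinearMap.id_comp, h1, hΦ.unital]
  · intro s b hs hdir hsa hb
    have h := hΦ.normal (conjBy U '' s) (conjBy U b) (hs.image _)
      ?_ ?_ ⟨?_, ?_⟩
    · rwa [Set.image_image] at h
    · rintro _ ⟨a, ha, rfl⟩ _ ⟨a', ha', rfl⟩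
      obtain ⟨e, he, h1, h2⟩ := hdir a ha a' ha'
      exact ⟨_, ⟨e, he, rfl⟩, conjBy_mono U h1, conjBy_mono U h2⟩
    · rintro _ ⟨a, ha, rfl⟩
      exact (hsa a ha).conj_adjoint U
    · rintro _ ⟨a, ha, rfl⟩
      exact conjBy_mono U (hb.1 ha)
    · intro Y hY
      rw [← conjBy_conjBy_adjoint h1 Y]
      refine conjBy_mono U (hb.2 fun a ha => ?_)
      rw [← hinv a]
      exact conjBy_mono _ (hY ⟨a, ha, rfl⟩)

end

/-- Both sides are conjugation by W_m(a + b): the phases produced on the left and on the right of X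
cancel. This is why a displacement preserves covariance. -/
theorem conjBy_weylPow_comm (a b : Fin m × (Fin N ⊕ Fin N) → ℝ) (X : L2Pow N m →L[ℂ] L2Pow N m) :
    conjBy (weylPow a) (conjBy (weylPow b) X) = conjBy (weylPow b) (conjBy (weylPow a) X) := by
  have h : ∀ a b : Fin m × (Fin N ⊕ Fin N) → ℝ,
      conjBy (weylPow a) (conjBy (weylPow b) X) = conjBy (weylPow (a + b)) X := by
    intro a b
    rw [conjBy_apply, conjBy_apply, conjBy_apply, adjoint_weylPow, adjoint_weylPow,
      adjoint_weylPow, ContinuousLinearMap.comp_assoc, ContinuousLinearMap.comp_assoc,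
      weylPow_comp, ← ContinuousLinearMap.comp_assoc, weylPow_comp, ContinuousLinearMap.smul_comp,
      ContinuousLinearMap.comp_smul, ContinuousLinearMap.comp_smul, smul_smul, ← Complex.exp_add,
      neg_add_rev a b]
    have hph : sympPow (-b) (-a) = -sympPow a b := by
      rw [sympPow, sympPow, flat_neg, flat_neg, symp_neg_left, symp_neg_right, neg_neg, symp_swap]
    rw [hph]
    simp
  rw [h, h, add_comm]

theorem exists_channel_of_displacement
    {B : Matrix (Fin m × (Fin N ⊕ Fin N)) (Fin m × (Fin N ⊕ Fin N)) ℝ}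
    {c : Fin m × (Fin N ⊕ Fin N) → ℝ} (hΨ : IsChannel Ψ)
    (hcov : IsCovariant weyl (weylDiag N m) Ψ) (h : HasGaussianForm Ψ B c)
    (c' : Fin m × (Fin N ⊕ Fin N) → ℝ) :
    ∃ Ψ' : (L2Pow N m →L[ℂ] L2Pow N m) →ₗ[ℂ] (L2 (Fin N) →L[ℂ] L2 (Fin N)),
      IsChannel Ψ' ∧ IsCovariant weyl (weylDiag N m) Ψ' ∧ HasGaussianForm Ψ' B c' := by
  -- Conjugation by W_m(a) multiplies W_m(z) by exp(-iσ(a, z)), with σ the symplectic form, so a is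
  -- chosen to represent c' - c.
  obtain ⟨a, ha⟩ := exists_sympPow_eq_dotProduct (c' - c)
  refine ⟨Ψ ∘ₗ conjBy (weylPow a), hΨ.comp_conjBy ?_ ?_, fun w X => ?_, fun z => ?_⟩
  · rw [adjoint_weylPow, weylPow_eq_weyl_flat, weylPow_eq_weyl_flat, flat_neg, weyl_comp_neg]
  · rw [adjoint_weylPow, weylPow_eq_weyl_flat, weylPow_eq_weyl_flat, flat_neg, weyl_neg_comp]
  · rw [LinearMap.comp_apply, LinearMap.comp_apply, ← hcov w]
    exact congrArg Ψ (conjBy_weylPow_comm a _ X)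
  · rw [LinearMap.comp_apply, conjBy_apply, weylPow_conj, LinearMap.map_smul Ψ, h z, smul_smul,
      ← Complex.exp_add, ha, sub_dotProduct]
    congr 2
    push_cast
    ring

end Displacement

end WeylChannel

end

/-! ### The characterization of Gaussian covariant channels -/

open WeylChannel
theorem mainTheorem12 (N m : ℕ) (hN : 1 ≤ N) (hm : 1 ≤ m)
    (Ψ : (L2Pow N m →L[ℂ] L2Pow N m) →ₗ[ℂ] (L2 (Fin N) →L[ℂ] L2 (Fin N)))
    (hΨ : IsChannel Ψ) (hcov : IsCovariant weyl (weylDiag N m) Ψ) :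
    (IsGaussianChannel Ψ ↔
      ∃ B : Matrix (Fin m × (Fin N ⊕ Fin N)) (Fin m × (Fin N ⊕ Fin N)) ℝ,
        B.IsSymm ∧ (blockMat B).PosSemidef ∧
          ∃ c : Fin m × (Fin N ⊕ Fin N) → ℝ, HasGaussianForm Ψ B c) ∧
    -- the vector `c` is arbitrary
    (∀ (B : Matrix (Fin m × (Fin N ⊕ Fin N)) (Fin m × (Fin N ⊕ Fin N)) ℝ)
      (c : Fin m × (Fin N ⊕ Fin N) → ℝ),
      B.IsSymm → (blockMat B).PosSemidef → HasGaussianForm Ψ B c →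
        ∀ c' : Fin m × (Fin N ⊕ Fin N) → ℝ,
          ∃ Ψ' : (L2Pow N m →L[ℂ] L2Pow N m) →ₗ[ℂ] (L2 (Fin N) →L[ℂ] L2 (Fin N)),
            IsChannel Ψ' ∧ IsCovariant weyl (weylDiag N m) Ψ' ∧ IsGaussianChannel Ψ' ∧
              HasGaussianForm Ψ' B c') := by
  refine ⟨⟨fun hG => hG.exists_hasGaussianForm hΨ hcov, ?_⟩, ?_⟩
  · rintro ⟨B, hB, hpos, c, h⟩
    exact h.isGaussianChannel hB hpos
  · intro B c hB hpos h c'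
    obtain ⟨Ψ', h1, h2, h3⟩ := exists_channel_of_displacement hΨ hcov h c'
    exact ⟨Ψ', h1, h2, h3.isGaussianChannel hB hpos, h3⟩
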